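/- Let $n\in\{0,1,2,\dots\}$, let $\lambda,\kappa\in\mathbb{C}$ with $\operatorname{Re}\lambda>-\tfrac12$ and $\operatorname{Re}\kappa<\tfrac12$, and let $-1<x<1$. Let $C_n^\lambda$ be the Gegenbauer polynomial, and let $P_\nu^\mu$, $Q_\nu^\mu$ be the associated Legendre functions of the first and second kind on the cut $(-1,1)$ (the Ferrers functions), i.e. $$P_\nu^\mu(x)=\Big(\frac{1+x}{1-x}\Big)^{\mu/2}\frac{1}{\Gamma(1-\mu)}\,{}_2F_1\Big(\nu+1,-\nu;1-\mu;\frac{1-x}{2}\Big),$$ $$Q_\nu^\mu(x)=\frac{\pi}{2}\Big[-\sin\frac{\pi(\nu+\mu)}{2}\,w_1(x)+\cos\frac{\pi(\nu+\mu)}{2}\,w_2(x)\Big]\qquad(\nu+\mu\neq-1,-2,\dots),$$ where $$w_1(x)=\frac{2^\mu\,\Gamma(\frac{\nu+\mu+1}{2})}{\sqrt\pi\,\Gamma(\frac{\nu-\mu}{2}+1)}(1-x^2)^{-\mu/2}{}_2F_1\Big(-\frac{\nu+\mu}{2},\frac{\nu-\mu+1}{2};\frac12;x^2\Big),$$ $$w_2(x)=\frac{2^{\mu+1}\,\Gamma(\frac{\nu+\mu}{2}+1)}{\sqrt\pi\,\Gamma(\frac{\nu-\mu+1}{2})}\,x\,(1-x^2)^{-\mu/2}{}_2F_1\Big(\frac{1-\nu-\mu}{2},\frac{\nu-\mu}{2}+1;\frac32;x^2\Big).$$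 Powers of positive numbers are principal; ${}_2F_1/\Gamma(1-\mu)$ is the regularized Gauss function, defined for every $\mu$. At $\lambda=0$ the removable singularities are filled by continuity: $\frac{n+\lambda}{\lambda}C_n^\lambda(t)$ means $1$ if $n=0$ and $2T_n(t)$ (Chebyshev polynomial) if $n\ge1$, and $(n+\lambda)\Gamma(n+2\lambda)$ means $\frac12$ if $n=0$. Then $t\mapsto(1-t^2)^{\lambda-1/2}(x-t)^{-\kappa-1/2}\,\frac{n+\lambda}{\lambda}C_n^\lambda(t)$ is integrable on $(-1,x)$, and $$\frac{n+\lambda}{\lambda}\int_{-1}^{x}\frac{(1-t^2)^{\lambda-1/2}C_n^\lambda(t)}{(x-t)^{\kappa+1/2}}\,dt=(-1)^n\,\frac{\sqrt\pi\,(n+\lambda)\,\Gamma(n+2\lambda)\,\Gamma(\frac12-\kappa)}{2^{\lambda-1/2}\,n!\,\Gamma(\lambda+1)}\,(1-x^2)^{(\lambda-\kappa)/2}\,P_{n+\lambda-1/2}^{\kappa-\lambda}(-x).$$ Moreover, if $\kappa+\frac12\notin\{0,-1,-2,\dots\}$, the same integral expression equals $$\frac{\sqrt\pi\,(n+\lambda)\,\Gamma(n+2\lambda)}{2^{\lambda-3/2}\,n!\,\Gamma(\lambda+1)\,\Gamma(\kappa+\frac12)}\,(1-x^2)^{(\lambda-\kappa)/2}\Big\{Q_{n+\lambda-1/2}^{\kappa-\lambda}(x)-\frac{\pi}{2}P_{n+\lambda-1/2}^{\kappa-\lambda}(x)\cot\big[\pi(\kappa+\tfrac12)\big]\Big\},$$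 and if $\kappa+\frac12\in\{0,-1,-2,\dots\}$, where the cotangent has a pole, it equals the limit of this expression, with $n,\lambda,x$ fixed, as $\kappa'\to\kappa$ ($\kappa'\ne\kappa$, $\kappa'$ replacing $\kappa$). -/

import Mathlib

open Filter Topology

/-- The Gegenbauer polynomial `C_n^l(t)` for complex `l`, by its three-term recurrence
`(n+2) C_{n+2}^l(t) = 2 (n+1+l) t C_{n+1}^l(t) - (n+2l) C_n^l(t)`,
`C_0^l = 1`, `C_1^l(t) = 2 l t`. -/
noncomputable def gegenbauer : ℕ → ℂ → ℂ → ℂ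
  | 0, _, _ => 1
  | 1, l, t => 2 * l * t
  | (n + 2), l, t =>
      (2 * ((n : ℂ) + 1 + l) * t * gegenbauer (n + 1) l t
        - ((n : ℂ) + 2 * l) * gegenbauer n l t) / ((n : ℂ) + 2)

/-- `((n+l)/l) C_n^l(t)`. At `l = 0` this quotient has a removable singularity, with value `1` for
`n = 0` and `2 T_n(t)` (Chebyshev polynomial) for `n ≥ 1`; see `tendsto_weightedGegenbauer`. -/
noncomputable def weightedGegenbauer (n : ℕ) (l t : ℂ) : ℂ :=
  if l = 0 then (if n = 0 then 1 else 2 * (Polynomial.Chebyshev.T ℂ n).eval t)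
  else ((n : ℂ) + l) / l * gegenbauer n l t

/-- `(n+l) Γ(n+2l)`. For `n = 0` this has a removable singularity at `l = 0`, with value `1/2`;
see `tendsto_gammaFactor`. -/
noncomputable def gammaFactor (n : ℕ) (l : ℂ) : ℂ :=
  if n = 0 ∧ l = 0 then 1 / 2 else ((n : ℂ) + l) * Complex.Gamma ((n : ℂ) + 2 * l)

/-- The associated Legendre function of the first kind on the cut `(-1, 1)`,
`P_ν^μ(x) = ((1+x)/(1-x))^{μ/2} F(ν+1, -ν; 1-μ; (1-x)/2) / Γ(1-μ)`,
the quotient `F(a, b; c; z) / Γ(c)` being the regularized Gauss function. -/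
noncomputable def ferrersP (ν μ : ℂ) (x : ℝ) : ℂ :=
  (((1 + x) / (1 - x) : ℝ) : ℂ) ^ (μ / 2)
    * Complex.regularizedGaussHGFun (ν + 1) (-ν) (1 - μ) (((1 - x) / 2 : ℝ) : ℂ)

/-- The even solution `w₁` of the associated Legendre equation on `(-1, 1)`, normalized by
`w₁ = 2^μ Γ((ν+μ+1)/2) / Γ((ν-μ)/2+1) (1-x²)^{-μ/2}
  F(-(ν+μ)/2, (ν-μ+1)/2; 1/2; x²) / Γ(1/2)`. -/
noncomputable def ferrersW₁ (ν μ : ℂ) (x : ℝ) : ℂ :=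
  (2 : ℂ) ^ μ * Complex.Gamma ((ν + μ + 1) / 2) / Complex.Gamma ((ν - μ) / 2 + 1)
    * ((1 - x ^ 2 : ℝ) : ℂ) ^ (-μ / 2)
    * Complex.regularizedGaussHGFun (-(ν + μ) / 2) ((ν - μ + 1) / 2) (1 / 2) ((x ^ 2 : ℝ) : ℂ)

/-- The odd solution `w₂` of the associated Legendre equation on `(-1, 1)`, normalized by
`w₂ = 2^μ Γ((ν+μ)/2+1) / Γ((ν-μ+1)/2) x (1-x²)^{-μ/2}
  F((1-ν-μ)/2, (ν-μ)/2+1; 3/2; x²) / Γ(3/2)`. -/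
noncomputable def ferrersW₂ (ν μ : ℂ) (x : ℝ) : ℂ :=
  (2 : ℂ) ^ μ * Complex.Gamma ((ν + μ) / 2 + 1) / Complex.Gamma ((ν - μ + 1) / 2)
    * (x : ℂ) * ((1 - x ^ 2 : ℝ) : ℂ) ^ (-μ / 2)
    * Complex.regularizedGaussHGFun ((1 - ν - μ) / 2) ((ν - μ) / 2 + 1) (3 / 2) ((x ^ 2 : ℝ) : ℂ)

/-- The associated Legendre function of the second kind `Q_ν^μ(x)` on the cut `(-1, 1)`, meaningful
when `ν + μ` is not a negative integer:
`Q_ν^μ = (π/2) (-sin(π(ν+μ)/2) w₁ + cos(π(ν+μ)/2) w₂)`.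
Unlike the expression through `P_ν^μ` and `P_ν^{-μ}`, this holds for integer `μ` too. -/
noncomputable def ferrersQ (ν μ : ℂ) (x : ℝ) : ℂ :=
  (Real.pi : ℂ) / 2 *
    (-Complex.sin ((Real.pi : ℂ) * (ν + μ) / 2) * ferrersW₁ ν μ x
      + Complex.cos ((Real.pi : ℂ) * (ν + μ) / 2) * ferrersW₂ ν μ x)

/-- The integrand `((n+l)/l) (1-t²)^{l-1/2} (x-t)^{-κ-1/2} C_n^l(t)`. -/
noncomputable def gegenbauerIntegrand (n : ℕ) (l κ : ℂ) (x t : ℝ) : ℂ :=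
  ((1 - t ^ 2 : ℝ) : ℂ) ^ (l - 1 / 2) * ((x - t : ℝ) : ℂ) ^ (-κ - 1 / 2)
    * weightedGegenbauer n l (t : ℂ)

/-- The combination of `Q_{n+l-1/2}^{κ-l}(x)` and `P_{n+l-1/2}^{κ-l}(x)` with the coefficient
`cot(π(κ+1/2))`; meaningful when `κ + 1/2` is not an integer. -/
noncomputable def cotCombination (n : ℕ) (l κ : ℂ) (x : ℝ) : ℂ :=
  (√Real.pi : ℂ) * gammaFactor n l
      / ((2 : ℂ) ^ (l - 3 / 2) * (n.factorial : ℂ) * Complex.Gamma (l + 1)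
          * Complex.Gamma (κ + 1 / 2))
    * ((1 - x ^ 2 : ℝ) : ℂ) ^ ((l - κ) / 2)
    * (ferrersQ (n + l - 1 / 2) (κ - l) x
        - (Real.pi : ℂ) / 2 * ferrersP (n + l - 1 / 2) (κ - l) x
            * Complex.cot ((Real.pi : ℂ) * (κ + 1 / 2)))

theorem tendsto_gammaFactor (n : ℕ) :
    Tendsto (fun l : ℂ => ((n : ℂ) + l) * Complex.Gamma ((n : ℂ) + 2 * l)) (𝓝[≠] 0)
      (𝓝 (gammaFactor n 0)) := by
  rcases Nat.eq_zero_or_pos n with rfl | hn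
  · have h2 : Tendsto (fun l : ℂ => 2 * l) (𝓝[≠] 0) (𝓝[≠] 0) := by
      refine tendsto_nhdsWithin_iff.2 ⟨?_, ?_⟩
      · have : Tendsto (fun l : ℂ => 2 * l) (𝓝 0) (𝓝 (2 * 0)) :=
          (continuous_const.mul continuous_id).tendsto 0
        rw [mul_zero] at this
        exact this.mono_left nhdsWithin_le_nhds
      · filter_upwards [self_mem_nhdsWithin] with l hl
        simpa using hl
    have h := ((Complex.tendsto_self_mul_Gamma_nhds_zero.comp h2).const_mul (1 / 2 : ℂ))
    have e : gammaFactor 0 0 = 1 / 2 * 1 := by simp [gammaFactor]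
    rw [e]
    refine h.congr fun l => ?_
    simp only [Function.comp, Nat.cast_zero, zero_add]
    ring
  · have hne : n ≠ 0 := hn.ne'
    have e : gammaFactor n 0 = ((n : ℂ) + 0) * Complex.Gamma ((n : ℂ) + 2 * 0) := by
      simp [gammaFactor, hne]
    rw [e]
    have hG : ContinuousAt Complex.Gamma ((n : ℂ) + 2 * 0) := by
      refine (Complex.differentiableAt_Gamma _ fun m hm => ?_).continuousAt
      have := congrArg Complex.re hm
      simp at this
      have h1 : (0 : ℝ) < n := by exact_mod_cast hn
      have h2 : (0 : ℝ) ≤ m := by positivity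
      linarith
    have hi : ContinuousAt (fun l : ℂ => (n : ℂ) + 2 * l) 0 := by fun_prop
    have hc : ContinuousAt (fun l : ℂ => Complex.Gamma ((n : ℂ) + 2 * l)) 0 :=
      ContinuousAt.comp (f := fun l : ℂ => (n : ℂ) + 2 * l) (g := Complex.Gamma) hG hi
    have hl : ContinuousAt (fun l : ℂ => (n : ℂ) + l) 0 := by fun_prop
    exact (hl.mul hc).tendsto.mono_left nhdsWithin_le_nhds

theorem tendsto_gegenbauer_div (n : ℕ) (t : ℂ) :
    Tendsto (fun l : ℂ => gegenbauer (n + 1) l t / l) (𝓝[≠] 0)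
      (𝓝 (2 * (Polynomial.Chebyshev.T ℂ (n + 1 : ℕ)).eval t / (n + 1))) := by
  induction n using Nat.strong_induction_on with
  | _ n ih =>
    match n with
    | 0 =>
      have e : (2 * (Polynomial.Chebyshev.T ℂ (0 + 1 : ℕ)).eval t / ((0 : ℕ) + 1) : ℂ)
          = 2 * t := by simp
      rw [e]
      refine tendsto_const_nhds.congr' ?_
      filter_upwards [self_mem_nhdsWithin] with l hl
      have hl' : l ≠ 0 := hl
      simp only [gegenbauer]
      field_simp
    | 1 =>
      have h0 := ih 0 (by omega)
      have hl : Tendsto (fun l : ℂ => ((0 : ℕ) : ℂ) + 1 + l) (𝓝[≠] 0) (𝓝 (((0 : ℕ) : ℂ) + 1 + 0)) :=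
        ((continuous_const.add continuous_id).tendsto 0).mono_left nhdsWithin_le_nhds
      have h := ((((hl.const_mul 2).mul_const t).mul h0).sub_const 2).div_const 2
      have e : (2 * (Polynomial.Chebyshev.T ℂ (1 + 1 : ℕ)).eval t / ((1 : ℕ) + 1) : ℂ)
          = (2 * (((0 : ℕ) : ℂ) + 1 + 0) * t
            * (2 * (Polynomial.Chebyshev.T ℂ (0 + 1 : ℕ)).eval t / ((0 : ℕ) + 1)) - 2) / 2 := by
        have h2 : ((1 + 1 : ℕ) : ℤ) = 2 := by norm_num
        rw [h2, Polynomial.Chebyshev.T_two]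
        simp
        ring
      rw [e]
      refine h.congr' ?_
      filter_upwards [self_mem_nhdsWithin] with l hl
      have hl' : l ≠ 0 := hl
      simp only [gegenbauer, zero_add, Nat.cast_zero]
      field_simp
    | n + 2 =>
      have h0 := ih n (by omega)
      have h1 := ih (n + 1) (by omega)
      have ha : Tendsto (fun l : ℂ => 2 * (((n + 1 : ℕ) : ℂ) + 1 + l) * t) (𝓝[≠] 0)
          (𝓝 (2 * (((n + 1 : ℕ) : ℂ) + 1 + 0) * t)) :=
        (Continuous.tendsto (by fun_prop) 0).mono_left nhdsWithin_le_nhds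
      have hb : Tendsto (fun l : ℂ => ((n + 1 : ℕ) : ℂ) + 2 * l) (𝓝[≠] 0)
          (𝓝 (((n + 1 : ℕ) : ℂ) + 2 * 0)) :=
        (Continuous.tendsto (by fun_prop) 0).mono_left nhdsWithin_le_nhds
      have h := ((ha.mul h1).sub (hb.mul h0)).div_const (((n + 1 : ℕ) : ℂ) + 2)
      have hT : (Polynomial.Chebyshev.T ℂ (n + 2 + 1 : ℕ)).eval t
          = 2 * t * (Polynomial.Chebyshev.T ℂ (n + 1 + 1 : ℕ)).eval t
            - (Polynomial.Chebyshev.T ℂ (n + 1 : ℕ)).eval t := by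
        have h3 := Polynomial.Chebyshev.T_add_two ℂ ((n : ℤ) + 1)
        have e1 : ((n + 2 + 1 : ℕ) : ℤ) = (n : ℤ) + 1 + 2 := by push_cast; ring
        have e2 : ((n + 1 + 1 : ℕ) : ℤ) = (n : ℤ) + 1 + 1 := by push_cast; ring
        have e3 : ((n + 1 : ℕ) : ℤ) = (n : ℤ) + 1 := by push_cast; ring
        rw [e1, e2, e3, h3]
        simp
      have hn1 : (n : ℂ) + 1 ≠ 0 := by exact_mod_cast Nat.succ_ne_zero n
      have hn2 : (n : ℂ) + 1 + 1 ≠ 0 := by exact_mod_cast Nat.succ_ne_zero (n + 1)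
      have hn3 : (n : ℂ) + 1 + 2 ≠ 0 := by exact_mod_cast Nat.succ_ne_zero (n + 2)
      have hn4 : (n : ℂ) + 2 + 1 ≠ 0 := by exact_mod_cast Nat.succ_ne_zero (n + 2)
      refine (h.congr' ?_).trans (le_of_eq ?_)
      · filter_upwards [self_mem_nhdsWithin] with l hl
        have hl' : l ≠ 0 := hl
        simp only [gegenbauer]
        field_simp
      · congr 1
        rw [hT]
        push_cast
        field_simp
        ring

/-- The value of `weightedGegenbauer` at `l = 0` is the limit of `((n+l)/l) C_n^l(t)`. -/
theorem tendsto_weightedGegenbauer (n : ℕ) (t : ℂ) :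
    Tendsto (fun l : ℂ => ((n : ℂ) + l) / l * gegenbauer n l t) (𝓝[≠] 0)
      (𝓝 (weightedGegenbauer n 0 t)) := by
  match n with
  | 0 =>
    have e : weightedGegenbauer 0 0 t = 1 := by simp [weightedGegenbauer]
    rw [e]
    refine tendsto_const_nhds.congr' ?_
    filter_upwards [self_mem_nhdsWithin] with l hl
    have hl' : l ≠ 0 := hl
    simp [gegenbauer, hl']
  | n + 1 =>
    have hn1 : (n : ℂ) + 1 ≠ 0 := by exact_mod_cast Nat.succ_ne_zero n
    have ha : Tendsto (fun l : ℂ => ((n + 1 : ℕ) : ℂ) + l) (𝓝[≠] 0) (𝓝 (((n + 1 : ℕ) : ℂ) + 0)) :=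
      (Continuous.tendsto (by fun_prop) 0).mono_left nhdsWithin_le_nhds
    have h := ha.mul (tendsto_gegenbauer_div n t)
    have e : weightedGegenbauer (n + 1) 0 t = (((n + 1 : ℕ) : ℂ) + 0)
        * (2 * (Polynomial.Chebyshev.T ℂ (n + 1 : ℕ)).eval t / (n + 1)) := by
      simp only [weightedGegenbauer, if_true, Nat.succ_ne_zero, if_false]
      push_cast
      field_simp
      ring
    rw [e]
    refine h.congr fun l => ?_
    ring

/-! The substitution t = -1 + (1+x)u turns the integral into a Beta-type integral over (0,1). With y
= (1+x)/2 the Gegenbauer factor becomes, up to the sign (-1)^n from parity, a constant multiple of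
(1-z)^(l-1/2) C_n^l(1-2z) at z = yu, and this is itself a Gauss function with lower parameter l+1/2
(`weightedGegenbauer_mul_cpow`), because both sides satisfy the same recurrence in n. Integrating
its power series termwise against u^(l-1/2) (1-u)^(-κ-1/2) only replaces the lower parameter by
l+1-κ (`integral_beta_mul_gegenbauerGauss`). The result is the Gauss function that defines P at -x,
since 1-μ = l+1-κ and (1-(-x))/2 = y.

The second form follows from the reflection x → -x of P (`ferrersP_neg`). As Q is defined through an
even and an odd solution w₁, w₂, reflection is immediate once P = cos θ w₁ + sin θ w₂ is known, with
θ = π(ν+μ)/2. That identity is Euler's transformation followed by a quadratic transformation. The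
quadratic transformation is obtained for upper parameters of positive real part by expanding one
Beta-type integral in two ways, at x = 1 and at x = 0. It is then carried to all parameters by a
relation linking (a,b), (a+1,b+1), (a+2,b+2), satisfied by both sides.

At the poles of the cotangent no formula is needed: the integral is continuous in κ by dominated
convergence, and it equals the combination at all nearby κ' ≠ κ. -/

/-! ### Power series of the Gauss function and of the binomial -/

/-- The `k`-th coefficient of the regularized Gauss series. -/
noncomputable def gaussCoeff (a b c : ℂ) (k : ℕ) : ℂ :=
  (ascPochhammer ℂ k).eval a * (ascPochhammer ℂ k).eval b
    / (k.factorial * Complex.Gamma (c + k))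

theorem HasSum.congr_terms {f g : ℕ → ℂ} {S : ℂ} (h : HasSum g S) (e : ∀ k, f k = g k) :
    HasSum f S :=
  (funext e : f = g) ▸ h

theorem ascPochhammer_eval_succ_left (k : ℕ) (a : ℂ) :
    (ascPochhammer ℂ (k + 1)).eval a = a * (ascPochhammer ℂ k).eval (a + 1) := by
  simp [ascPochhammer_succ_left, Polynomial.eval_comp]

theorem mem_eball_zero_one {z : ℂ} (hz : ‖z‖ < 1) : z ∈ Metric.eball (0 : ℂ) 1 := by
  rw [mem_eball_zero_iff, ← ofReal_norm, ENNReal.ofReal_lt_one]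
  exact hz

theorem hasSum_gaussCoeff (a b c : ℂ) {z : ℂ} (hz : ‖z‖ < 1) :
    HasSum (fun k => gaussCoeff a b c k * z ^ k) (Complex.regularizedGaussHGFun a b c z) := by
  have h := FormalMultilinearSeries.hasSum _ (Metric.eball_subset_eball
    (Complex.radius_regularizedGaussHGFunSeries_ge_one a b c) (mem_eball_zero_one hz))
  refine h.congr_terms fun k => ?_
  simp [Complex.regularizedGaussHGFunSeries, Complex.regularizedHGFunSeries,
    Complex.regularizedHGFunCoeff, gaussCoeff, mul_comm]

theorem Summable.norm_mul_pow {f : ℕ → ℂ} {r : ℝ} (hr0 : 0 ≤ r)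
    (h : Summable fun k => f k * (r : ℂ) ^ k) : Summable fun k => ‖f k‖ * r ^ k := by
  simpa [abs_of_nonneg hr0] using summable_norm_iff.2 h

theorem norm_ofReal_lt_one {r : ℝ} (hr : |r| < 1) : ‖(r : ℂ)‖ < 1 := by
  simpa using hr

theorem summable_norm_gaussCoeff (a b c : ℂ) {r : ℝ} (hr0 : 0 ≤ r) (hr : r < 1) :
    Summable fun k => ‖gaussCoeff a b c k‖ * r ^ k :=
  Summable.norm_mul_pow hr0
    (hasSum_gaussCoeff a b c (norm_ofReal_lt_one (by rwa [abs_of_nonneg hr0]))).summable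

theorem hasSum_binomial (s : ℂ) {z : ℂ} (hz : ‖z‖ < 1) :
    HasSum (fun k : ℕ => (ascPochhammer ℂ k).eval s / (k.factorial : ℂ) * z ^ k)
      ((1 - z) ^ (-s)) := by
  have h := (Complex.one_div_one_sub_cpow_hasFPowerSeriesOnBall_zero s).hasSum
    (mem_eball_zero_one hz)
  rw [zero_add, one_div, ← Complex.cpow_neg] at h
  refine h.congr_terms fun k => ?_
  -- The binomial series at hand has coefficients `Ring.choose (s + k - 1) k`; multichoose numbers
  -- link them to Pochhammer symbols.
  have h2 := Ring.factorial_nsmul_multichoose_eq_ascPochhammer s k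
  have h3 : Ring.choose (s + k - 1) k = Ring.multichoose s k := by
    rw [Ring.choose]; congr 1; ring
  have hk : (k.factorial : ℂ) ≠ 0 := by exact_mod_cast k.factorial_ne_zero
  rw [Polynomial.ascPochhammer_smeval_eq_eval] at h2
  rw [FormalMultilinearSeries.ofScalars_apply_eq, h3, ← h2, smul_eq_mul, nsmul_eq_mul]
  field_simp

theorem summable_norm_binomial (s : ℂ) {r : ℝ} (hr0 : 0 ≤ r) (hr : r < 1) :
    Summable fun k : ℕ => ‖(ascPochhammer ℂ k).eval s / (k.factorial : ℂ)‖ * r ^ k :=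
  Summable.norm_mul_pow hr0
    (hasSum_binomial s (norm_ofReal_lt_one (by rwa [abs_of_nonneg hr0]))).summable

/-- Multiplying a power series by its variable shifts the coefficients. -/
def shiftCoeff (f : ℕ → ℂ) : ℕ → ℂ
  | 0 => 0
  | k + 1 => f k

theorem hasSum_shiftCoeff {f : ℕ → ℂ} {z S : ℂ} (h : HasSum (fun k => f k * z ^ k) S) :
    HasSum (fun k => shiftCoeff f k * z ^ k) (z * S) := by
  rw [← hasSum_nat_add_iff' 1]
  simpa [shiftCoeff, pow_succ, mul_assoc, mul_comm, mul_left_comm] using h.mul_left z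

/-- No exception is needed at the poles, where the inverse is 0, the true value of 1/Γ. Hence the
coefficient identities below hold for all parameters of the regularized function. -/
theorem inv_Gamma_succ (s : ℂ) :
    (Complex.Gamma s)⁻¹ = s * (Complex.Gamma (s + 1))⁻¹ :=
  Complex.one_div_Gamma_eq_self_mul_one_div_Gamma_add_one s

theorem gaussCoeff_eq (a b c : ℂ) (k : ℕ) :
    gaussCoeff a b c k = (ascPochhammer ℂ k).eval a * (ascPochhammer ℂ k).eval b
      * ((k.factorial : ℂ)⁻¹ * (Complex.Gamma (c + k))⁻¹) := by
  rw [gaussCoeff, div_eq_mul_inv, mul_inv]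

theorem inv_factorial (k : ℕ) :
    ((k.factorial : ℂ))⁻¹ = (k + 1) * (((k + 1).factorial : ℕ) : ℂ)⁻¹ := by
  have hk : (k.factorial : ℂ) ≠ 0 := by exact_mod_cast k.factorial_ne_zero
  have hk1 : (k + 1 : ℂ) ≠ 0 := by exact_mod_cast k.succ_ne_zero
  rw [Nat.factorial_succ]
  push_cast
  field_simp

/-! ### Gauss functions with shifted parameters -/

/-- The hypergeometric differential equation as a relation between Gauss functions with shifted
parameters. -/
theorem regularizedGaussHGFun_shift (a b c : ℂ) {z : ℂ} (hz : ‖z‖ < 1) :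
    Complex.regularizedGaussHGFun a b c z
      = (c - (a + b + 1) * z) * Complex.regularizedGaussHGFun (a + 1) (b + 1) (c + 1) z
        + z * (1 - z) * ((a + 1) * (b + 1))
          * Complex.regularizedGaussHGFun (a + 2) (b + 2) (c + 2) z := by
  have h0 := hasSum_gaussCoeff a b c hz
  have h1 := hasSum_gaussCoeff (a + 1) (b + 1) (c + 1) hz
  have h2 := hasSum_gaussCoeff (a + 2) (b + 2) (c + 2) hz
  have h1' := hasSum_shiftCoeff h1
  have h2' := hasSum_shiftCoeff h2
  have h2'' := hasSum_shiftCoeff h2'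
  have h := (((h1.mul_left c).sub (h1'.mul_left (a + b + 1))).add
    (h2'.mul_left ((a + 1) * (b + 1)))).sub (h2''.mul_left ((a + 1) * (b + 1)))
  refine (h0.unique (h.congr_terms fun k => ?_)).trans (by ring)
  match k with
  | 0 =>
    simp [shiftCoeff, gaussCoeff, inv_Gamma_succ c, div_eq_mul_inv]
  | 1 =>
    have e1 : c + 1 + 1 = c + 2 := by ring
    simp [shiftCoeff, gaussCoeff_eq, inv_Gamma_succ (c + 1), e1]
    ring
  | k + 2 =>
    have e (x : ℂ) : (ascPochhammer ℂ (k + 2)).eval x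
        = x * (x + 1) * (ascPochhammer ℂ k).eval (x + 2) := by
      rw [ascPochhammer_eval_succ_left, ascPochhammer_eval_succ_left, add_assoc x 1 1,
        one_add_one_eq_two, mul_assoc]
    have e1 (x : ℂ) : (ascPochhammer ℂ (k + 1)).eval (x + 1)
        = (x + 1) * (ascPochhammer ℂ k).eval (x + 2) := by
      rw [ascPochhammer_eval_succ_left, add_assoc x 1 1, one_add_one_eq_two]
    have e2 (x : ℂ) : (ascPochhammer ℂ (k + 2)).eval (x + 1)
        = (x + 1) * (ascPochhammer ℂ k).eval (x + 2) * (x + 2 + k) := by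
      rw [ascPochhammer_succ_eval, e1]; push_cast; ring
    have g0 := inv_Gamma_succ (c + k + 2)
    have c1 : c + (k + 2 : ℕ) = c + k + 2 := by push_cast; ring
    have c2 : c + 1 + (k + 2 : ℕ) = c + k + 2 + 1 := by push_cast; ring
    have c3 : c + 1 + (k + 1 : ℕ) = c + k + 2 := by push_cast; ring
    have c4 : c + 2 + (k + 1 : ℕ) = c + k + 2 + 1 := by push_cast; ring
    have c5 : c + 2 + (k : ℂ) = c + k + 2 := by ring
    simp only [shiftCoeff, gaussCoeff_eq, e a, e b, e1 a, e1 b, e2 a, e2 b,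
      ascPochhammer_succ_eval k (a + 2), ascPochhammer_succ_eval k (b + 2), c1, c2, c3, c4, c5,
      g0, inv_factorial k, inv_factorial (k + 1)]
    push_cast
    ring

/-- The even part in x of the relation `evenOddGauss_shift`; checked coefficient by coefficient. -/
theorem regularizedGaussHGFun_half_shift (a b : ℂ) {z : ℂ} (hz : ‖z‖ < 1) :
    Complex.regularizedGaussHGFun a b (1 / 2) z
      = -(a + b + 1 / 2) * z * Complex.regularizedGaussHGFun (a + 1) (b + 1) (3 / 2) z
        + (1 - z) * Complex.regularizedGaussHGFun (a + 1) (b + 1) (1 / 2) z := by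
  have h0 := hasSum_gaussCoeff a b (1 / 2) hz
  have h1 := hasSum_gaussCoeff (a + 1) (b + 1) (1 / 2) hz
  have h1' := hasSum_shiftCoeff h1
  have h2' := hasSum_shiftCoeff (hasSum_gaussCoeff (a + 1) (b + 1) (3 / 2) hz)
  have h := ((h2'.mul_left (-(a + b + 1 / 2))).add h1).sub h1'
  refine (h0.unique (h.congr_terms fun k => ?_)).trans (by ring)
  match k with
  | 0 => simp [shiftCoeff, gaussCoeff]
  | k + 1 =>
    have g0 := inv_Gamma_succ (1 / 2 + k)
    have c1 : (1 / 2 : ℂ) + (k + 1 : ℕ) = 1 / 2 + k + 1 := by push_cast; ring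
    have c2 : (3 / 2 : ℂ) + k = 1 / 2 + k + 1 := by ring
    simp only [shiftCoeff, gaussCoeff_eq, ascPochhammer_eval_succ_left k a,
      ascPochhammer_eval_succ_left k b, ascPochhammer_succ_eval, c1, c2,
      g0, inv_factorial k]
    ring

/-- The odd part in x of the relation `evenOddGauss_shift`. -/
theorem regularizedGaussHGFun_three_halves_shift (a b : ℂ) {z : ℂ} (hz : ‖z‖ < 1) :
    (a - 1 / 2) * (b - 1 / 2) * Complex.regularizedGaussHGFun a b (3 / 2) z
      = -(a + b - 1 / 2) * Complex.regularizedGaussHGFun a b (1 / 2) z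
        + a * b * (1 - z) * Complex.regularizedGaussHGFun (a + 1) (b + 1) (3 / 2) z := by
  have h0 := hasSum_gaussCoeff a b (3 / 2) hz
  have h1 := hasSum_gaussCoeff a b (1 / 2) hz
  have h2 := hasSum_gaussCoeff (a + 1) (b + 1) (3 / 2) hz
  have h2' := hasSum_shiftCoeff h2
  have h := ((h1.mul_left (-(a + b - 1 / 2))).add (h2.mul_left (a * b))).sub (h2'.mul_left (a * b))
  refine ((h0.mul_left ((a - 1 / 2) * (b - 1 / 2))).unique
    (h.congr_terms fun k => ?_)).trans (by ring)
  match k with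
  | 0 =>
    have g0 := inv_Gamma_succ (1 / 2)
    have c1 : (1 / 2 : ℂ) + 1 = 3 / 2 := by ring
    simp only [shiftCoeff, gaussCoeff_eq, Nat.cast_zero, add_zero, g0, c1, ascPochhammer_zero,
      Polynomial.eval_one]
    ring
  | k + 1 =>
    have g0 := inv_Gamma_succ (1 / 2 + k + 1)
    have c1 : (1 / 2 : ℂ) + (k + 1 : ℕ) = 1 / 2 + k + 1 := by push_cast; ring
    have c2 : (3 / 2 : ℂ) + (k + 1 : ℕ) = 1 / 2 + k + 1 + 1 := by push_cast; ring
    have c3 : (3 / 2 : ℂ) + k = 1 / 2 + k + 1 := by ring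
    simp only [shiftCoeff, gaussCoeff_eq, ascPochhammer_eval_succ_left k a,
      ascPochhammer_eval_succ_left k b, ascPochhammer_succ_eval, c1, c2, c3,
      g0, inv_factorial k]
    ring

/-! ### Euler's transformation through formal power series -/

/-- The hypergeometric differential operator on formal power series. -/
noncomputable def gaussOperator (a b c : ℂ) (f : PowerSeries ℂ) : PowerSeries ℂ :=
  PowerSeries.X * PowerSeries.derivative ℂ (PowerSeries.derivative ℂ f)
    - PowerSeries.X * (PowerSeries.X * PowerSeries.derivative ℂ (PowerSeries.derivative ℂ f))
    + PowerSeries.C c * PowerSeries.derivative ℂ f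
    - PowerSeries.C (a + b + 1) * (PowerSeries.X * PowerSeries.derivative ℂ f)
    - PowerSeries.C (a * b) * f

theorem coeff_gaussOperator (a b c : ℂ) (f : PowerSeries ℂ) (k : ℕ) :
    PowerSeries.coeff k (gaussOperator a b c f)
      = (k + 1) * (c + k) * PowerSeries.coeff (k + 1) f
        - (a + k) * (b + k) * PowerSeries.coeff k f := by
  -- An opaque name for the constant keeps `map_add` from splitting it inside `PowerSeries.C`.
  obtain ⟨e, he⟩ : ∃ e, e = a + b + 1 := ⟨_, rfl⟩
  rw [gaussOperator, ← he]
  match k with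
  | 0 =>
    rw [map_sub, map_sub, map_add, map_sub]
    simp only [PowerSeries.coeff_derivative, PowerSeries.coeff_C_mul,
      PowerSeries.coeff_zero_X_mul]
    push_cast
    ring
  | 1 =>
    have h : PowerSeries.coeff 1 (PowerSeries.X * (PowerSeries.X *
        PowerSeries.derivative ℂ (PowerSeries.derivative ℂ f))) = 0 := by
      rw [show (1 : ℕ) = 0 + 1 from rfl, PowerSeries.coeff_succ_X_mul]
      simp
    simp only [map_sub, map_add, h, PowerSeries.coeff_C_mul]
    rw [show (1 : ℕ) = 0 + 1 from rfl]
    simp only [PowerSeries.coeff_succ_X_mul, PowerSeries.coeff_derivative]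
    push_cast
    rw [he]
    ring
  | k + 2 =>
    simp only [map_sub, map_add, PowerSeries.coeff_C_mul]
    rw [show k + 2 = k + 1 + 1 from rfl]
    simp only [PowerSeries.coeff_succ_X_mul, PowerSeries.coeff_derivative]
    push_cast
    rw [he]
    ring

theorem gaussOperator_gaussCoeff (a b c : ℂ) :
    gaussOperator a b c (PowerSeries.mk (gaussCoeff a b c)) = 0 := by
  ext k
  have c1 : c + (k + 1 : ℕ) = c + k + 1 := by push_cast; ring
  rw [coeff_gaussOperator]
  simp only [PowerSeries.coeff_mk, gaussCoeff_eq, ascPochhammer_succ_eval, inv_Gamma_succ (c + k),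
    inv_factorial k, c1, map_zero]
  ring

/-- The equation is a first-order recurrence for the coefficients. Its leading factor (k+1)(c+k)
never vanishes when c is not a nonpositive integer, so the constant term determines the series. -/
theorem eq_of_gaussOperator_eq_zero {a b c : ℂ} (hc : ∀ m : ℕ, c ≠ -m) {f g : PowerSeries ℂ}
    (hf : gaussOperator a b c f = 0) (hg : gaussOperator a b c g = 0)
    (h0 : PowerSeries.coeff 0 f = PowerSeries.coeff 0 g) : f = g := by
  ext k
  induction k with
  | zero => exact h0
  | succ k ih =>
    have h1 := coeff_gaussOperator a b c f k
    have h2 := coeff_gaussOperator a b c g k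
    rw [hf, map_zero] at h1
    rw [hg, map_zero] at h2
    have hk : (k + 1 : ℂ) * (c + k) ≠ 0 :=
      mul_ne_zero (by exact_mod_cast k.succ_ne_zero) fun h => hc k (eq_neg_of_add_eq_zero_left h)
    refine mul_left_cancel₀ hk ?_
    rw [ih] at h1
    linear_combination h2 - h1

/-- The formal binomial series of `(1 - X) ^ (-s)`. -/
noncomputable def binomialPowerSeries (s : ℂ) : PowerSeries ℂ :=
  PowerSeries.mk fun k => (ascPochhammer ℂ k).eval s / (k.factorial : ℂ)

theorem one_sub_X_mul_derivative_binomialPowerSeries (s : ℂ) :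
    (1 - PowerSeries.X) * PowerSeries.derivative ℂ (binomialPowerSeries s)
      = PowerSeries.C s * binomialPowerSeries s := by
  ext k
  rw [sub_mul, one_mul, map_sub, PowerSeries.coeff_C_mul]
  match k with
  | 0 =>
    simp [-PowerSeries.coeff_zero_eq_constantCoeff, PowerSeries.coeff_derivative,
      binomialPowerSeries, PowerSeries.coeff_zero_X_mul]
  | k + 1 =>
    rw [PowerSeries.coeff_succ_X_mul]
    simp only [PowerSeries.coeff_derivative, binomialPowerSeries, PowerSeries.coeff_mk,
      ascPochhammer_succ_eval, div_eq_mul_inv, inv_factorial (k + 1)]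
    push_cast
    ring

/-- Multiplication by (1-X)^(c-a-b) carries solutions of the equation with parameters (c-a, c-b, c)
to solutions with parameters (a, b, c); uniqueness then identifies the product. -/
theorem binomialPowerSeries_mul_gaussCoeff {a b c : ℂ} (hc : ∀ m : ℕ, c ≠ -m) :
    binomialPowerSeries (a + b - c) * PowerSeries.mk (gaussCoeff (c - a) (c - b) c)
      = PowerSeries.mk (gaussCoeff a b c) := by
  refine eq_of_gaussOperator_eq_zero hc ?_ (gaussOperator_gaussCoeff a b c) ?_
  · have hF := gaussOperator_gaussCoeff (c - a) (c - b) c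
    set F := PowerSeries.mk (gaussCoeff (c - a) (c - b) c)
    have hM := one_sub_X_mul_derivative_binomialPowerSeries (a + b - c)
    set M := binomialPowerSeries (a + b - c)
    have hM' := congrArg (PowerSeries.derivative ℂ) hM
    have hX : PowerSeries.derivative ℂ (1 - PowerSeries.X : PowerSeries ℂ) = -1 := by
      simp
    have hC (r : ℂ) : PowerSeries.derivative ℂ (PowerSeries.C r) = 0 := by
      ext k
      simp
    simp only [Derivation.leibniz, smul_eq_mul, hX, hC] at hM'
    have hne : (1 - PowerSeries.X : PowerSeries ℂ) ≠ 0 := by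
      intro h
      have := congrArg (PowerSeries.coeff 0) h
      simp at this
    -- After multiplication by 1 - X, the derivatives of the binomial factor can be eliminated with
    -- its first-order equation `hM` and the derivative `hM'` of that equation.
    refine (mul_eq_zero.1 ?_).resolve_left hne
    simp only [gaussOperator, Derivation.leibniz, map_add,
      smul_eq_mul, map_sub, map_add, map_mul, map_one] at hF hM hM' ⊢
    set X : PowerSeries ℂ := PowerSeries.X
    set M1 := PowerSeries.derivative ℂ M
    set M2 := PowerSeries.derivative ℂ M1
    set F1 := PowerSeries.derivative ℂ F
    set F2 := PowerSeries.derivative ℂ F1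
    set a' := PowerSeries.C a
    set b' := PowerSeries.C b
    set c' := PowerSeries.C c
    linear_combination (1 - X) * M * hF + (2 * X * (1 - X) * F1 + (c' - (a' + b' + 1) * X) * F
      + X * (a' + b' - c' + 1) * F) * hM + X * (1 - X) * F * hM'
  · rw [PowerSeries.coeff_mul]
    simp [binomialPowerSeries, gaussCoeff]

theorem tsum_mul_tsum_powers {f g : ℕ → ℂ} {z : ℂ} (hf : Summable fun k => f k * z ^ k)
    (hg : Summable fun k => g k * z ^ k) :
    (∑' k, f k * z ^ k) * (∑' k, g k * z ^ k)
      = ∑' k, (PowerSeries.coeff k (PowerSeries.mk f * PowerSeries.mk g)) * z ^ k := by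
  rw [tsum_mul_tsum_eq_tsum_sum_antidiagonal_of_summable_norm hf.norm hg.norm]
  refine tsum_congr fun k => ?_
  rw [PowerSeries.coeff_mul, Finset.sum_mul]
  refine Finset.sum_congr rfl fun p hp => ?_
  rw [← Finset.HasAntidiagonal.mem_antidiagonal.1 hp, pow_add, PowerSeries.coeff_mk,
    PowerSeries.coeff_mk]
  ring

/-- Euler's transformation. -/
theorem regularizedGaussHGFun_euler {a b c : ℂ} (hc : ∀ m : ℕ, c ≠ -m) {z : ℂ} (hz : ‖z‖ < 1) :
    Complex.regularizedGaussHGFun a b c z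
      = (1 - z) ^ (c - a - b) * Complex.regularizedGaussHGFun (c - a) (c - b) c z := by
  have h1 := hasSum_binomial (a + b - c) hz
  have h2 := hasSum_gaussCoeff (c - a) (c - b) c hz
  rw [show -(a + b - c) = c - a - b by ring] at h1
  have h := binomialPowerSeries_mul_gaussCoeff (a := a) (b := b) hc
  rw [binomialPowerSeries] at h
  rw [← h1.tsum_eq, ← h2.tsum_eq, tsum_mul_tsum_powers h1.summable h2.summable, h,
    ← (hasSum_gaussCoeff a b c hz).tsum_eq]
  simp only [PowerSeries.coeff_mk]

/-! ### Termwise integration and integrals of Beta type -/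

/-- Dominated convergence: the k-th term is at most ‖f k‖ r^k ‖h‖, and these bounds sum to a
constant times the integrable ‖h‖. -/
theorem hasSum_integral_mul_powers {h : ℝ → ℂ}
    (hh : IntervalIntegrable h MeasureTheory.volume 0 1) {v : ℝ → ℝ} (hv : Continuous v) {r : ℝ}
    (hvr : ∀ u ∈ Set.Ioc (0 : ℝ) 1, |v u| ≤ r) {f : ℕ → ℂ}
    (hf : Summable fun k => ‖f k‖ * r ^ k) {φ : ℝ → ℂ}
    (hφ : ∀ u ∈ Set.Ioc (0 : ℝ) 1, HasSum (fun k => f k * (v u : ℂ) ^ k) (φ u)) :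
    HasSum (fun k => f k * ∫ u in (0 : ℝ)..1, h u * (v u : ℂ) ^ k)
      (∫ u in (0 : ℝ)..1, h u * φ u) := by
  have e : Set.uIoc (0 : ℝ) 1 = Set.Ioc 0 1 := Set.uIoc_of_le zero_le_one
  simp_rw [← intervalIntegral.integral_const_mul]
  refine intervalIntegral.hasSum_integral_of_dominated_convergence
    (fun k t => ‖f k‖ * r ^ k * ‖h t‖) (fun k => ?_) (fun k => ?_) ?_ ?_ ?_
  · rw [e]
    have h1 : MeasureTheory.AEStronglyMeasurable h
        (MeasureTheory.volume.restrict (Set.Ioc (0 : ℝ) 1)) := hh.1.aestronglyMeasurable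
    have h2 : Continuous fun u => ((v u : ℂ)) ^ k := by fun_prop
    exact (h1.mul h2.aestronglyMeasurable).const_mul _
  · refine Eventually.of_forall fun t ht => ?_
    rw [e] at ht
    have h3 : |v t| ^ k ≤ r ^ k := pow_le_pow_left₀ (abs_nonneg _) (hvr t ht) k
    rw [norm_mul, norm_mul, norm_pow, Complex.norm_real, Real.norm_eq_abs]
    calc ‖f k‖ * (‖h t‖ * |v t| ^ k) ≤ ‖f k‖ * (‖h t‖ * r ^ k) := by gcongr
      _ = _ := by ring
  · exact Eventually.of_forall fun t _ => hf.mul_right _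
  · simp_rw [tsum_mul_right]
    exact hh.norm.const_mul _
  · refine Eventually.of_forall fun t ht => ?_
    rw [e] at ht
    refine ((hφ t ht).mul_left (h t)).congr_terms fun k => ?_
    ring

theorem ofReal_cpow_eq_exp {r : ℝ} (hr : 0 < r) (s : ℂ) :
    (r : ℂ) ^ s = Complex.exp (s * (Real.log r : ℝ)) := by
  rw [Complex.cpow_def_of_ne_zero (by exact_mod_cast hr.ne'), Complex.ofReal_log hr.le, mul_comm]

theorem ofReal_eq_exp_log {r : ℝ} (hr : 0 < r) : (r : ℂ) = Complex.exp (Real.log r : ℝ) := by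
  rw [← Complex.ofReal_exp, Real.exp_log hr]

theorem sq_add_one_sub_sq_pos (u : ℝ) : 0 < u ^ 2 + (1 - u) ^ 2 := by
  nlinarith [sq_nonneg (2 * u - 1)]

theorem integral_Ioo_eq_intervalIntegral (f : ℝ → ℂ) :
    ∫ u in Set.Ioo (0 : ℝ) 1, f u = ∫ u in (0 : ℝ)..1, f u := by
  rw [intervalIntegral.integral_of_le zero_le_one, MeasureTheory.integral_Ioc_eq_integral_Ioo]

theorem intervalIntegral_congr_Ioo {f g : ℝ → ℂ} (h : ∀ u ∈ Set.Ioo (0 : ℝ) 1, f u = g u) :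
    ∫ u in (0 : ℝ)..1, f u = ∫ u in (0 : ℝ)..1, g u := by
  rw [← integral_Ioo_eq_intervalIntegral, ← integral_Ioo_eq_intervalIntegral]
  exact MeasureTheory.setIntegral_congr_fun measurableSet_Ioo h

/-- The substitution w = u²/(u²+(1-u)²), an increasing bijection of (0,1), turns the integral into
half a Beta integral. -/
theorem integral_cpow_mul_sq_add_sq (A B : ℂ) :
    ∫ u in (0 : ℝ)..1, (u : ℂ) ^ (A - 1) * (1 - (u : ℂ)) ^ (B - 1)
        * ((u ^ 2 + (1 - u) ^ 2 : ℝ) : ℂ) ^ (-(A + B) / 2)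
      = Complex.betaIntegral (A / 2) (B / 2) / 2 := by
  set D : ℝ → ℝ := fun u => u ^ 2 + (1 - u) ^ 2 with hD
  have hDpos (u : ℝ) : 0 < D u := sq_add_one_sub_sq_pos u
  set p : ℝ → ℝ := fun u => u ^ 2 / D u with hp
  have hder (u : ℝ) : HasDerivAt p (2 * u * (1 - u) / D u ^ 2) u := by
    have h1 : HasDerivAt (fun u : ℝ => u ^ 2) (2 * u) u := by simpa using hasDerivAt_pow 2 u
    have h2 : HasDerivAt D (2 * u - 2 * (1 - u)) u := by
      have := h1.add (((hasDerivAt_id u).const_sub 1).pow 2)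
      refine this.congr_deriv ?_
      simp
      ring
    refine (h1.div h2 (hDpos u).ne').congr_deriv ?_
    rw [show 2 * u * D u - u ^ 2 * (2 * u - 2 * (1 - u)) = 2 * u * (1 - u) by
      rw [show D u = u ^ 2 + (1 - u) ^ 2 from rfl]; ring]
  have hmono : MonotoneOn p (Set.Ioo 0 1) := by
    refine monotoneOn_of_deriv_nonneg (convex_Ioo 0 1)
      (fun u _ => (hder u).continuousAt.continuousWithinAt)
      (fun u _ => (hder u).differentiableAt.differentiableWithinAt) fun u hu => ?_
    rw [interior_Ioo] at hu
    rw [(hder u).deriv]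
    have := hDpos u
    have h1 := hu.1
    have h2 : 0 < 1 - u := sub_pos.2 hu.2
    positivity
  have himage : p '' Set.Ioo 0 1 = Set.Ioo 0 1 := by
    ext w
    constructor
    · rintro ⟨u, hu, rfl⟩
      have h1 := hu.1
      have h2 : 0 < 1 - u := sub_pos.2 hu.2
      refine ⟨div_pos (by positivity) (hDpos u), (div_lt_one (hDpos u)).2 ?_⟩
      simp only [hD]
      nlinarith
    · intro hw
      have hs : 0 < √w := Real.sqrt_pos.2 hw.1
      have ht : 0 < √(1 - w) := Real.sqrt_pos.2 (sub_pos.2 hw.2)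
      -- The preimage of w solves u/(1-u) = √w/√(1-w).
      refine ⟨√w / (√w + √(1 - w)),
        ⟨by positivity, (div_lt_one (by positivity)).2 (by linarith)⟩, ?_⟩
      have e1 : 1 - √w / (√w + √(1 - w)) = √(1 - w) / (√w + √(1 - w)) := by
        field_simp
        ring
      have e2 := Real.sq_sqrt hw.1.le
      have e3 := Real.sq_sqrt (sub_pos.2 hw.2).le
      simp only [hp, hD, e1, div_pow]
      rw [← add_div, e2, e3]
      field_simp
      ring
  have h := MeasureTheory.integral_image_eq_integral_deriv_smul_of_monotoneOn measurableSet_Ioo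
    (fun u _ => (hder u).hasDerivWithinAt) hmono
    (fun w : ℝ => (w : ℂ) ^ (A / 2 - 1) * (1 - (w : ℂ)) ^ (B / 2 - 1))
  rw [himage, integral_Ioo_eq_intervalIntegral] at h
  rw [Complex.betaIntegral, h, integral_Ioo_eq_intervalIntegral, ← intervalIntegral.integral_div]
  refine intervalIntegral_congr_Ioo fun u hu => ?_
  have h1 := hu.1
  have h2 : 0 < 1 - u := sub_pos.2 hu.2
  have h3 := hDpos u
  have e1 : 1 - ((p u : ℝ) : ℂ) = (((1 - u) ^ 2 / D u : ℝ) : ℂ) := by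
    rw [← Complex.ofReal_one, ← Complex.ofReal_sub]
    congr 1
    simp only [hp, hD] at h3 ⊢
    field_simp
    ring
  have e2 : 1 - (u : ℂ) = ((1 - u : ℝ) : ℂ) := by push_cast; ring
  have e3 : ((2 * u * (1 - u) / D u ^ 2 : ℝ) : ℂ)
      = 2 * Complex.exp (Real.log u + Real.log (1 - u) - 2 * Real.log (D u)) := by
    rw [Complex.exp_sub, Complex.exp_add, two_mul (Real.log (D u) : ℂ), Complex.exp_add,
      ← ofReal_eq_exp_log h1, ← ofReal_eq_exp_log h2, ← ofReal_eq_exp_log h3]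
    push_cast
    ring
  rw [Complex.real_smul, e1, e2, e3, ofReal_cpow_eq_exp h1, ofReal_cpow_eq_exp h2,
    ofReal_cpow_eq_exp h3, ofReal_cpow_eq_exp (by positivity : 0 < p u),
    ofReal_cpow_eq_exp (by positivity : 0 < (1 - u) ^ 2 / D u), Real.log_div (by positivity) h3.ne',
    Real.log_div (by positivity) h3.ne', Real.log_pow, Real.log_pow, mul_assoc 2,
    mul_div_cancel_left₀ _ (two_ne_zero : (2 : ℂ) ≠ 0), ← Complex.exp_add, ← Complex.exp_add,
    ← Complex.exp_add, ← Complex.exp_add]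
  congr 1
  push_cast
  ring

theorem Gamma_add_natCast {z : ℂ} (hz : ∀ m : ℕ, z ≠ -m) (k : ℕ) :
    Complex.Gamma (z + k) = (ascPochhammer ℂ k).eval z * Complex.Gamma z := by
  induction k with
  | zero => simp
  | succ k ih =>
    have h : z + k ≠ 0 := fun h => hz k (eq_neg_of_add_eq_zero_left h)
    push_cast
    rw [← add_assoc, Complex.Gamma_add_one _ h, ih, ascPochhammer_succ_eval]
    ring

theorem ne_neg_natCast_of_re_pos {z : ℂ} (hz : 0 < z.re) (m : ℕ) : z ≠ -m := by
  rintro rfl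
  simp at hz
  linarith [(Nat.cast_nonneg m : (0 : ℝ) ≤ m)]

theorem ofReal_sqrt_pi_ne_zero : ((√Real.pi : ℝ) : ℂ) ≠ 0 := by
  exact_mod_cast (Real.sqrt_pos.2 Real.pi_pos).ne'

theorem ofReal_sqrt_pi_mul_self : ((√Real.pi : ℝ) : ℂ) * (√Real.pi : ℝ) = (Real.pi : ℂ) := by
  rw [← Complex.ofReal_mul, Real.mul_self_sqrt Real.pi_pos.le]

theorem Gamma_two_mul (s : ℂ) :
    Complex.Gamma (2 * s)
      = Complex.Gamma s * Complex.Gamma (s + 1 / 2) * 2 ^ (2 * s - 1) / (√Real.pi : ℝ) := by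
  have h2 : (2 : ℂ) ^ (1 - 2 * s) * 2 ^ (2 * s - 1) = 1 := by
    rw [← Complex.cpow_add _ _ two_ne_zero]; simp
  rw [Complex.Gamma_mul_Gamma_add_half, eq_div_iff ofReal_sqrt_pi_ne_zero]
  linear_combination (-Complex.Gamma (2 * s) * (√Real.pi : ℝ)) * h2

/-- Expansion in z: each term is a Beta integral with denominator Γ(a+b+2k), which the duplication
formula splits into Γ((a+b)/2+k) Γ((a+b+1)/2+k). The first factor cancels against the binomial
coefficient, the second gives the lower parameter. -/
theorem integral_cpow_mul_one_sub_cpow {a b : ℂ} (ha : 0 < a.re) (hb : 0 < b.re) {z : ℝ}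
    (hz0 : 0 ≤ z) (hz1 : z < 1) :
    ∫ u in (0 : ℝ)..1, (u : ℂ) ^ (a - 1) * (1 - (u : ℂ)) ^ (b - 1)
        * (1 - ((4 * u * (1 - u) * z : ℝ) : ℂ)) ^ (-((a + b) / 2))
      = Complex.Gamma a * Complex.Gamma b * (√Real.pi : ℝ) * 2 ^ (1 - a - b)
        / Complex.Gamma ((a + b) / 2)
        * Complex.regularizedGaussHGFun a b ((a + b + 1) / 2) z := by
  set s := (a + b) / 2 with hs
  have hsre : 0 < s.re := by
    simp [hs]; linarith
  have hvr : ∀ u ∈ Set.Ioc (0 : ℝ) 1, |4 * u * (1 - u) * z| ≤ z := fun u hu => by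
    have h1 : 0 ≤ 1 - u := sub_nonneg.2 hu.2
    have h2 := hu.1
    rw [abs_of_nonneg (by positivity)]
    have h3 : 4 * u * (1 - u) ≤ 1 := by nlinarith [sq_nonneg (2 * u - 1)]
    nlinarith
  have h := hasSum_integral_mul_powers (Complex.betaIntegral_convergent ha hb)
    (v := fun u => 4 * u * (1 - u) * z) (by fun_prop) hvr (summable_norm_binomial s hz0 hz1)
    (fun u hu => hasSum_binomial s (norm_ofReal_lt_one ((hvr u hu).trans_lt hz1)))
  refine h.unique (((hasSum_gaussCoeff a b ((a + b + 1) / 2)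
    (norm_ofReal_lt_one (by rwa [abs_of_nonneg hz0]))).mul_left _).congr_terms fun k => ?_)
  have hI : ∫ u in (0 : ℝ)..1, (u : ℂ) ^ (a - 1) * (1 - (u : ℂ)) ^ (b - 1)
        * ((4 * u * (1 - u) * z : ℝ) : ℂ) ^ k
      = (4 * z) ^ k * Complex.betaIntegral (a + k) (b + k) := by
    rw [Complex.betaIntegral, ← intervalIntegral.integral_const_mul]
    refine intervalIntegral_congr_Ioo fun u hu => ?_
    have h1 : (u : ℂ) ≠ 0 := by exact_mod_cast hu.1.ne'
    have h2 : 1 - (u : ℂ) ≠ 0 := by exact_mod_cast (sub_pos.2 hu.2).ne'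
    rw [show a + k - 1 = a - 1 + k by ring, show b + k - 1 = b - 1 + k by ring,
      Complex.cpow_add _ _ h1, Complex.cpow_add _ _ h2, Complex.cpow_natCast, Complex.cpow_natCast]
    push_cast
    simp only [mul_pow]
    ring
  have hak : 0 < (a + k).re := by simp; positivity
  have hbk : 0 < (b + k).re := by simp; positivity
  have hsk : 0 < (s + k).re := by simp; positivity
  have e1 : a + k + (b + k) = 2 * (s + k) := by rw [hs]; ring
  have e2 : s + k + 1 / 2 = (a + b + 1) / 2 + k := by rw [hs]; ring
  have e3 : (2 : ℂ) ^ (2 * (s + k) - 1) = (2 ^ (1 - a - b))⁻¹ * 4 ^ k := by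
    rw [← Complex.cpow_neg, show 2 * (s + k) - 1 = -(1 - a - b) + (2 * k : ℕ) by
      rw [hs]; push_cast; ring, Complex.cpow_add _ _ two_ne_zero, Complex.cpow_natCast, pow_mul]
    norm_num
  have h2 : (2 : ℂ) ^ (1 - a - b) ≠ 0 := by simp [Complex.cpow_eq_zero_iff]
  have hs0 := Complex.Gamma_ne_zero_of_re_pos hsre
  have hsk0 := Complex.Gamma_ne_zero_of_re_pos hsk
  have hk : (k.factorial : ℂ) ≠ 0 := by exact_mod_cast k.factorial_ne_zero
  have hpi := ofReal_sqrt_pi_ne_zero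
  rw [hI, Complex.betaIntegral_eq_Gamma_mul_div _ _ hak hbk, e1, Gamma_two_mul, e2, e3, gaussCoeff,
    Gamma_add_natCast (ne_neg_natCast_of_re_pos ha), Gamma_add_natCast (ne_neg_natCast_of_re_pos hb)]
  rw [Gamma_add_natCast (ne_neg_natCast_of_re_pos hsre)] at hsk0 ⊢
  have hps := left_ne_zero_of_mul hsk0
  rw [mul_pow]
  field_simp

/-- The integral of `integral_cpow_mul_one_sub_cpow` at z = (1-x)/2, now expanded in x. The base
factors as D(1-v) with D = u²+(1-u)² and v = -2u(1-u)x/D, where |v| ≤ |x| because 2u(1-u) ≤ D. -/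
theorem hasSum_integral_cpow_mul_sq_add_sq {a b : ℂ} (ha : 0 < a.re) (hb : 0 < b.re) {x : ℝ}
    (hx : |x| < 1) :
    HasSum (fun k : ℕ => Complex.Gamma ((a + k) / 2) * Complex.Gamma ((b + k) / 2)
        / (k.factorial : ℂ) * (-2 * x) ^ k)
      (2 * Complex.Gamma ((a + b) / 2) *
        ∫ u in (0 : ℝ)..1, (u : ℂ) ^ (a - 1) * (1 - (u : ℂ)) ^ (b - 1)
          * (1 - ((4 * u * (1 - u) * ((1 - x) / 2) : ℝ) : ℂ)) ^ (-((a + b) / 2))) := by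
  set s := (a + b) / 2 with hs
  have hsre : 0 < s.re := by
    simp [hs]; linarith
  set v : ℝ → ℝ := fun u => -2 * u * (1 - u) * x / (u ^ 2 + (1 - u) ^ 2) with hv
  have hcont : Continuous v :=
    Continuous.div (by fun_prop) (by fun_prop) fun u => (sq_add_one_sub_sq_pos u).ne'
  have hvr : ∀ u ∈ Set.Ioc (0 : ℝ) 1, |v u| ≤ |x| := fun u hu => by
    have h1 : 0 ≤ 1 - u := sub_nonneg.2 hu.2
    have h2 := hu.1
    have h3 := sq_add_one_sub_sq_pos u
    rw [hv, abs_div, abs_of_pos h3, div_le_iff₀ h3, abs_mul, mul_comm]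
    refine mul_le_mul_of_nonneg_left ?_ (abs_nonneg x)
    rw [show -2 * u * (1 - u) = -(2 * u * (1 - u)) by ring, abs_neg, abs_of_nonneg (by positivity)]
    nlinarith [sq_nonneg (2 * u - 1)]
  have hint : IntervalIntegrable (fun u : ℝ => (u : ℂ) ^ (a - 1) * (1 - (u : ℂ)) ^ (b - 1)
      * ((u ^ 2 + (1 - u) ^ 2 : ℝ) : ℂ) ^ (-s)) MeasureTheory.volume 0 1 := by
    refine (Complex.betaIntegral_convergent ha hb).mul_continuousOn ?_
    refine Continuous.continuousOn (continuous_iff_continuousAt.2 fun u => ?_)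
    have h3 := sq_add_one_sub_sq_pos u
    refine ContinuousAt.cpow (by fun_prop) (by fun_prop) ?_
    exact Complex.ofReal_mem_slitPlane.2 h3
  have h := hasSum_integral_mul_powers hint hcont hvr (summable_norm_binomial s (abs_nonneg x) hx)
    (fun u hu => hasSum_binomial s (norm_ofReal_lt_one ((hvr u hu).trans_lt hx)))
  have e : ∫ u in (0 : ℝ)..1, (u : ℂ) ^ (a - 1) * (1 - (u : ℂ)) ^ (b - 1)
          * (1 - ((4 * u * (1 - u) * ((1 - x) / 2) : ℝ) : ℂ)) ^ (-s)
      = ∫ u in (0 : ℝ)..1, (u : ℂ) ^ (a - 1) * (1 - (u : ℂ)) ^ (b - 1)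
        * ((u ^ 2 + (1 - u) ^ 2 : ℝ) : ℂ) ^ (-s) * (1 - (v u : ℂ)) ^ (-s) := by
    refine intervalIntegral_congr_Ioo fun u hu => ?_
    have h3 := sq_add_one_sub_sq_pos u
    have h4 := (abs_le.1 ((hvr u (Set.Ioo_subset_Ioc_self hu)).trans hx.le)).2
    have h5 : 1 - ((4 * u * (1 - u) * ((1 - x) / 2) : ℝ) : ℂ)
        = ((u ^ 2 + (1 - u) ^ 2 : ℝ) : ℂ) * ((1 - v u : ℝ) : ℂ) := by
      rw [← Complex.ofReal_mul, ← Complex.ofReal_one, ← Complex.ofReal_sub, hv]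
      congr 1
      field_simp
      ring
    rw [h5, Complex.mul_cpow_ofReal_nonneg h3.le (sub_nonneg.2 h4)]
    push_cast
    ring
  rw [e]
  refine (h.mul_left _).congr_terms fun k => ?_
  have hI : ∫ u in (0 : ℝ)..1, (u : ℂ) ^ (a - 1) * (1 - (u : ℂ)) ^ (b - 1)
        * ((u ^ 2 + (1 - u) ^ 2 : ℝ) : ℂ) ^ (-s) * (v u : ℂ) ^ k
      = (-2 * x) ^ k * (Complex.betaIntegral ((a + k) / 2) ((b + k) / 2) / 2) := by
    rw [← integral_cpow_mul_sq_add_sq, ← intervalIntegral.integral_const_mul]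
    refine intervalIntegral_congr_Ioo fun u hu => ?_
    have h1 : (u : ℂ) ≠ 0 := by exact_mod_cast hu.1.ne'
    have h2 : 1 - (u : ℂ) ≠ 0 := by exact_mod_cast (sub_pos.2 hu.2).ne'
    have h3 : ((u ^ 2 + (1 - u) ^ 2 : ℝ) : ℂ) ≠ 0 := by
      exact_mod_cast (sq_add_one_sub_sq_pos u).ne'
    rw [show a + k - 1 = a - 1 + k by ring, show b + k - 1 = b - 1 + k by ring,
      show -(a + k + (b + k)) / 2 = -s - k by rw [hs]; ring,
      Complex.cpow_add _ _ h1, Complex.cpow_add _ _ h2, Complex.cpow_sub _ _ h3,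
      Complex.cpow_natCast, Complex.cpow_natCast, Complex.cpow_natCast, hv, Complex.ofReal_div,
      div_pow]
    push_cast
    simp only [mul_pow]
    ring
  have hak : 0 < ((a + k) / 2).re := by simp; positivity
  have hbk : 0 < ((b + k) / 2).re := by simp; positivity
  have hsk : 0 < (s + k).re := by simp; positivity
  have e1 : (a + k) / 2 + (b + k) / 2 = s + k := by rw [hs]; ring
  have hs0 := Complex.Gamma_ne_zero_of_re_pos hsre
  have hsk0 := Complex.Gamma_ne_zero_of_re_pos hsk
  have hk : (k.factorial : ℂ) ≠ 0 := by exact_mod_cast k.factorial_ne_zero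
  rw [hI, Complex.betaIntegral_eq_Gamma_mul_div _ _ hak hbk, e1]
  rw [Gamma_add_natCast (ne_neg_natCast_of_re_pos hsre)] at hsk0 ⊢
  have hps := left_ne_zero_of_mul hsk0
  field_simp

/-! ### The quadratic transformation -/

/-- The duplication formula turns the factorials of the even terms into the denominators of a Gauss
series with lower parameter 1/2; the odd terms likewise lead to 3/2. -/
theorem factorial_two_mul (j : ℕ) :
    (((2 * j).factorial : ℕ) : ℂ)
      = j.factorial * Complex.Gamma (1 / 2 + j) * 4 ^ j / (√Real.pi : ℝ) := by
  have h := Gamma_two_mul (1 / 2 + j)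
  rw [show 2 * (1 / 2 + (j : ℂ)) = (2 * j : ℕ) + 1 by push_cast; ring, Complex.Gamma_nat_eq_factorial,
    show 1 / 2 + (j : ℂ) + 1 / 2 = j + 1 by ring, Complex.Gamma_nat_eq_factorial,
    add_sub_cancel_right, Complex.cpow_natCast, pow_mul] at h
  rw [h]
  norm_num
  ring

theorem factorial_two_mul_add_one (j : ℕ) :
    (((2 * j + 1).factorial : ℕ) : ℂ)
      = j.factorial * Complex.Gamma (3 / 2 + j) * (2 * 4 ^ j) / (√Real.pi : ℝ) := by
  have h := Gamma_two_mul (j + 1)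
  rw [show 2 * ((j : ℂ) + 1) = (2 * j + 1 : ℕ) + 1 by push_cast; ring,
    Complex.Gamma_nat_eq_factorial, show (j : ℂ) + 1 + 1 / 2 = 3 / 2 + j by ring,
    Complex.Gamma_nat_eq_factorial, add_sub_cancel_right, Complex.cpow_natCast, pow_succ,
    pow_mul] at h
  rw [h]
  norm_num
  ring

/-- The expansion at the origin of `F(a, b; (a+b+1)/2; (1-x)/2) / Γ((a+b+1)/2)`, split into its
even and odd parts. -/
noncomputable def evenOddGauss (a b : ℂ) (x : ℝ) : ℂ :=
  (Real.pi : ℂ) * (Complex.regularizedGaussHGFun (a / 2) (b / 2) (1 / 2) ((x ^ 2 : ℝ) : ℂ)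
      * ((Complex.Gamma ((a + 1) / 2))⁻¹ * (Complex.Gamma ((b + 1) / 2))⁻¹)
    - x * Complex.regularizedGaussHGFun ((a + 1) / 2) ((b + 1) / 2) (3 / 2) ((x ^ 2 : ℝ) : ℂ)
      * ((Complex.Gamma (a / 2))⁻¹ * (Complex.Gamma (b / 2))⁻¹))

theorem norm_ofReal_sq_lt_one {x : ℝ} (hx : |x| < 1) : ‖((x ^ 2 : ℝ) : ℂ)‖ < 1 := by
  refine norm_ofReal_lt_one ?_
  rw [abs_pow]
  exact pow_lt_one₀ (abs_nonneg x) hx two_ne_zero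

/-- Two expansions of the same integral are compared, the one in powers of x being split by parity
of the exponent. Positive real parts make the integral converge. -/
theorem regularizedGaussHGFun_quadratic_of_re_pos {a b : ℂ} (ha : 0 < a.re) (hb : 0 < b.re) {x : ℝ}
    (hx : |x| < 1) :
    Complex.regularizedGaussHGFun a b ((a + b + 1) / 2) (((1 - x) / 2 : ℝ) : ℂ)
      = evenOddGauss a b x := by
  have hx' := abs_lt.1 hx
  have hI := integral_cpow_mul_one_sub_cpow ha hb (z := (1 - x) / 2) (by linarith) (by linarith)
  have hS := hasSum_integral_cpow_mul_sq_add_sq ha hb hx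
  rw [hI] at hS
  have hz := norm_ofReal_sq_lt_one hx
  have hE := (hasSum_gaussCoeff (a / 2) (b / 2) (1 / 2) hz).mul_left
    ((√Real.pi : ℝ) * (Complex.Gamma (a / 2) * Complex.Gamma (b / 2)))
  have hO := (hasSum_gaussCoeff ((a + 1) / 2) ((b + 1) / 2) (3 / 2) hz).mul_left
    (-((√Real.pi : ℝ) * x * (Complex.Gamma ((a + 1) / 2) * Complex.Gamma ((b + 1) / 2))))
  have ha2 : 0 < (a / 2).re := by simp; positivity
  have hb2 : 0 < (b / 2).re := by simp; positivity
  have ha3 : 0 < ((a + 1) / 2).re := by simp; positivity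
  have hb3 : 0 < ((b + 1) / 2).re := by simp; positivity
  have hpi := ofReal_sqrt_pi_ne_zero
  set f : ℕ → ℂ := fun k : ℕ => Complex.Gamma ((a + k) / 2) * Complex.Gamma ((b + k) / 2)
        / (k.factorial : ℂ) * (-2 * x) ^ k with hf
  have hE' := hE.congr_terms (f := fun j => f (2 * j)) fun j => by
    have hg : Complex.Gamma (1 / 2 + j) ≠ 0 :=
      Complex.Gamma_ne_zero_of_re_pos (by simp; positivity)
    have hj : (j.factorial : ℂ) ≠ 0 := by exact_mod_cast j.factorial_ne_zero
    have e (y : ℂ) : (y + (2 * j : ℕ)) / 2 = y / 2 + j := by push_cast; ring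
    have h4 : (-2 * (x : ℂ)) ^ (2 * j) = 4 ^ j * ((x ^ 2 : ℝ) : ℂ) ^ j := by
      rw [pow_mul, ← mul_pow]
      congr 1
      push_cast
      ring
    simp only [hf]
    rw [e, e, Gamma_add_natCast (ne_neg_natCast_of_re_pos ha2),
      Gamma_add_natCast (ne_neg_natCast_of_re_pos hb2), factorial_two_mul, h4, gaussCoeff]
    field_simp
  have hO' := hO.congr_terms (f := fun j => f (2 * j + 1)) fun j => by
    have hg : Complex.Gamma (3 / 2 + j) ≠ 0 :=
      Complex.Gamma_ne_zero_of_re_pos (by simp; positivity)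
    have hj : (j.factorial : ℂ) ≠ 0 := by exact_mod_cast j.factorial_ne_zero
    have e (y : ℂ) : (y + (2 * j + 1 : ℕ)) / 2 = (y + 1) / 2 + j := by push_cast; ring
    have h4 : (-2 * (x : ℂ)) ^ (2 * j + 1) = -2 * x * (4 ^ j * ((x ^ 2 : ℝ) : ℂ) ^ j) := by
      rw [pow_succ, mul_comm, pow_mul, ← mul_pow]
      congr 2
      push_cast
      ring
    simp only [hf]
    rw [e, e, Gamma_add_natCast (ne_neg_natCast_of_re_pos ha3),
      Gamma_add_natCast (ne_neg_natCast_of_re_pos hb3), factorial_two_mul_add_one, h4, gaussCoeff]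
    field_simp
  have h := hS.unique (hE'.even_add_odd hO')
  have hsre : 0 < ((a + b) / 2).re := by simp; positivity
  have hs0 := Complex.Gamma_ne_zero_of_re_pos hsre
  have n1 := Complex.Gamma_ne_zero_of_re_pos ha2
  have n2 := Complex.Gamma_ne_zero_of_re_pos hb2
  have n3 := Complex.Gamma_ne_zero_of_re_pos ha3
  have n4 := Complex.Gamma_ne_zero_of_re_pos hb3
  have g (y : ℂ) : Complex.Gamma y
      = Complex.Gamma (y / 2) * Complex.Gamma ((y + 1) / 2) * 2 ^ (y - 1) / (√Real.pi : ℝ) := by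
    have := Gamma_two_mul (y / 2)
    rwa [mul_div_cancel₀ y two_ne_zero, ← add_div] at this
  have e2 : 2 * ((2 : ℂ) ^ (a - 1) * 2 ^ (b - 1) * 2 ^ (1 - a - b)) = 1 := by
    rw [← Complex.cpow_add _ _ two_ne_zero, ← Complex.cpow_add _ _ two_ne_zero,
      show a - 1 + (b - 1) + (1 - a - b) = -1 by ring, Complex.cpow_neg_one]
    norm_num
  rw [g a, g b] at h
  rw [evenOddGauss, ← ofReal_sqrt_pi_mul_self]
  set F0 := Complex.regularizedGaussHGFun a b ((a + b + 1) / 2) (((1 - x) / 2 : ℝ) : ℂ)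
  set F1 := Complex.regularizedGaussHGFun (a / 2) (b / 2) (1 / 2) ((x ^ 2 : ℝ) : ℂ)
  set F2 := Complex.regularizedGaussHGFun ((a + 1) / 2) ((b + 1) / 2) (3 / 2) ((x ^ 2 : ℝ) : ℂ)
  have h' : Complex.Gamma (a / 2) * Complex.Gamma ((a + 1) / 2)
        * (Complex.Gamma (b / 2) * Complex.Gamma ((b + 1) / 2)) * F0
        * (2 * ((2 : ℂ) ^ (a - 1) * 2 ^ (b - 1) * 2 ^ (1 - a - b)))
      = (√Real.pi : ℝ) * ((√Real.pi : ℝ) * (Complex.Gamma (a / 2) * Complex.Gamma (b / 2)) * F1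
        + -((√Real.pi : ℝ) * x * (Complex.Gamma ((a + 1) / 2) * Complex.Gamma ((b + 1) / 2)))
          * F2) := by
    rw [← h]
    field_simp
  rw [e2, mul_one] at h'
  generalize Complex.Gamma (a / 2) = A1 at *
  generalize Complex.Gamma (b / 2) = B1 at *
  generalize Complex.Gamma ((a + 1) / 2) = A2 at *
  generalize Complex.Gamma ((b + 1) / 2) = B2 at *
  field_simp
  linear_combination h'

/-- This is `regularizedGaussHGFun_shift` for lower parameter (a+b+1)/2 at (1-x)/2, where c -
(a+b+1)z = (a+b+1)x/2 and z(1-z) = (1-x²)/4. -/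
theorem evenOddGauss_shift (a b : ℂ) {x : ℝ} (hx : |x| < 1) :
    evenOddGauss a b x = (a + b + 1) / 2 * x * evenOddGauss (a + 1) (b + 1) x
      + (1 - x ^ 2) / 4 * ((a + 1) * (b + 1)) * evenOddGauss (a + 2) (b + 2) x := by
  have hz := norm_ofReal_sq_lt_one hx
  have h1 := regularizedGaussHGFun_half_shift (a / 2) (b / 2) hz
  have h2 := regularizedGaussHGFun_three_halves_shift ((a + 1) / 2) ((b + 1) / 2) hz
  have e1 (y : ℂ) : (y + 1 + 1) / 2 = y / 2 + 1 := by ring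
  have e2 (y : ℂ) : (y + 2 + 1) / 2 = (y + 1) / 2 + 1 := by ring
  have e3 (y : ℂ) : (y + 2) / 2 = y / 2 + 1 := by ring
  simp only [evenOddGauss, e1, e2, e3, inv_Gamma_succ ((a + 1) / 2), inv_Gamma_succ (a / 2),
    inv_Gamma_succ ((b + 1) / 2), inv_Gamma_succ (b / 2)]
  push_cast at h1 h2 ⊢
  rw [h1]
  set A1 := (Complex.Gamma (a / 2 + 1))⁻¹
  set B1 := (Complex.Gamma (b / 2 + 1))⁻¹
  linear_combination (-(Real.pi : ℂ) * x * A1 * B1) * h2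

/-- A quadratic transformation of the Gauss function. -/
theorem regularizedGaussHGFun_quadratic (a b : ℂ) {x : ℝ} (hx : |x| < 1) :
    Complex.regularizedGaussHGFun a b ((a + b + 1) / 2) (((1 - x) / 2 : ℝ) : ℂ)
      = evenOddGauss a b x := by
  have hx' := abs_lt.1 hx
  have hz : ‖(((1 - x) / 2 : ℝ) : ℂ)‖ < 1 :=
    norm_ofReal_lt_one (abs_lt.2 ⟨by linarith, by linarith⟩)
  -- Induction on half-planes: the shift relation determines the value at (a,b) from values with
  -- real parts larger by 1 and 2.
  have key (N : ℕ) : ∀ a b : ℂ, -(N : ℝ) < a.re → -(N : ℝ) < b.re →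
      Complex.regularizedGaussHGFun a b ((a + b + 1) / 2) (((1 - x) / 2 : ℝ) : ℂ)
        = evenOddGauss a b x := by
    induction N with
    | zero =>
      intro a b ha hb
      exact regularizedGaussHGFun_quadratic_of_re_pos (by simpa using ha) (by simpa using hb) hx
    | succ N ih =>
      intro a b ha hb
      push_cast at ha hb
      have h1 := ih (a + 1) (b + 1) (by simp; linarith) (by simp; linarith)
      have h2 := ih (a + 2) (b + 2) (by simp; linarith) (by simp; linarith)
      rw [evenOddGauss_shift a b hx, ← h1, ← h2, regularizedGaussHGFun_shift a b _ hz,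
        show (a + 1 + (b + 1) + 1) / 2 = (a + b + 1) / 2 + 1 by ring,
        show (a + 2 + (b + 2) + 1) / 2 = (a + b + 1) / 2 + 2 by ring]
      push_cast
      ring
  obtain ⟨N, hN⟩ := exists_nat_gt (max (-a.re) (-b.re))
  have := max_lt_iff.1 hN
  exact key N a b (by linarith) (by linarith)

/-! ### Ferrers functions under reflection -/

/-- Euler's reflection formula. The hypothesis matters at z = 0, -1, ..., where the left side is 0
by convention and the right side is not. -/
theorem Gamma_mul_sin {z : ℂ} (hz : Complex.sin (Real.pi * z) ≠ 0) :
    Complex.Gamma z * Complex.sin (Real.pi * z) = Real.pi * (Complex.Gamma (1 - z))⁻¹ := by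
  have h := Complex.Gamma_mul_Gamma_one_sub z
  rw [eq_div_iff hz] at h
  have hpi : (Real.pi : ℂ) ≠ 0 := by exact_mod_cast Real.pi_ne_zero
  have h0 : Complex.Gamma (1 - z) ≠ 0 := by
    intro h0
    rw [h0, mul_zero, zero_mul] at h
    exact hpi h.symm
  rw [eq_mul_inv_iff_mul_eq₀ h0]
  linear_combination h

/-- Euler's transformation produces upper parameters -(ν+μ) and ν-μ+1, whose sum plus 1 is twice
1-μ: exactly the case of the quadratic transformation. The reflection formula moves two reciprocal
Gammas to the numerators of w₁ and w₂, creating the cosine and the sine. -/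
theorem ferrersP_eq_cos_mul_add_sin_mul {ν μ : ℂ} (h : ∀ m : ℤ, ν + μ ≠ m)
    (hμ : ∀ m : ℕ, 1 - μ ≠ -m) {x : ℝ} (hx : |x| < 1) :
    ferrersP ν μ x = Complex.cos (Real.pi * (ν + μ) / 2) * ferrersW₁ ν μ x
      + Complex.sin (Real.pi * (ν + μ) / 2) * ferrersW₂ ν μ x := by
  have hx' := abs_lt.1 hx
  have hp : 0 < 1 + x := by linarith
  have hm : 0 < 1 - x := by linarith
  have hpm : 0 < 1 - x ^ 2 := by nlinarith
  have hz : ‖(((1 - x) / 2 : ℝ) : ℂ)‖ < 1 :=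
    norm_ofReal_lt_one (abs_lt.2 ⟨by linarith, by linarith⟩)
  have hpi : (Real.pi : ℂ) ≠ 0 := by exact_mod_cast Real.pi_ne_zero
  have hcos : Complex.sin (Real.pi * ((ν + μ + 1) / 2)) = Complex.cos (Real.pi * (ν + μ) / 2) := by
    rw [← Complex.sin_add_pi_div_two]
    congr 1
    ring
  have hsin : Complex.sin (Real.pi * ((ν + μ) / 2 + 1)) = -Complex.sin (Real.pi * (ν + μ) / 2) := by
    rw [← Complex.sin_add_pi]
    congr 1
    ring
  have hcos0 : Complex.cos (Real.pi * (ν + μ) / 2) ≠ 0 := by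
    intro h0
    obtain ⟨k, hk⟩ := Complex.cos_eq_zero_iff.1 h0
    refine h (2 * k + 1) (mul_left_cancel₀ hpi ?_)
    push_cast
    linear_combination 2 * hk
  have hsin0 : Complex.sin (Real.pi * (ν + μ) / 2) ≠ 0 := by
    intro h0
    obtain ⟨k, hk⟩ := Complex.sin_eq_zero_iff.1 h0
    refine h (2 * k) (mul_left_cancel₀ hpi ?_)
    push_cast
    linear_combination 2 * hk
  have g1 := Gamma_mul_sin (z := (ν + μ + 1) / 2) (by rwa [hcos])
  have g2 := Gamma_mul_sin (z := (ν + μ) / 2 + 1) (by rw [hsin]; exact neg_ne_zero.2 hsin0)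
  rw [hcos, show 1 - (ν + μ + 1) / 2 = (-(ν + μ) + 1) / 2 by ring] at g1
  rw [hsin, show 1 - ((ν + μ) / 2 + 1) = -(ν + μ) / 2 by ring] at g2
  have hE := regularizedGaussHGFun_euler (a := ν + 1) (b := -ν) hμ hz
  have hQ := regularizedGaussHGFun_quadratic (-(ν + μ)) (ν - μ + 1) hx
  rw [show (-(ν + μ) + (ν - μ + 1) + 1) / 2 = 1 - μ by ring] at hQ
  rw [show 1 - μ - (ν + 1) - -ν = -μ by ring, show 1 - μ - (ν + 1) = -(ν + μ) by ring,
    show 1 - μ - -ν = ν - μ + 1 by ring, hQ] at hE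
  have hpow : (((1 + x) / (1 - x) : ℝ) : ℂ) ^ (μ / 2) * (1 - (((1 - x) / 2 : ℝ) : ℂ)) ^ (-μ)
      = 2 ^ μ * ((1 - x ^ 2 : ℝ) : ℂ) ^ (-μ / 2) := by
    have e1 : 1 - (((1 - x) / 2 : ℝ) : ℂ) = (((1 + x) / 2 : ℝ) : ℂ) := by push_cast; ring
    have e2 : (2 : ℂ) = ((2 : ℝ) : ℂ) := by norm_num
    have e3 : 1 - x ^ 2 = (1 - x) * (1 + x) := by ring
    rw [e1, e3, e2, ofReal_cpow_eq_exp (by positivity), ofReal_cpow_eq_exp (by positivity),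
      ofReal_cpow_eq_exp (by positivity), ofReal_cpow_eq_exp (by positivity),
      Real.log_div hp.ne' hm.ne', Real.log_div hp.ne' two_ne_zero, Real.log_mul hm.ne' hp.ne',
      ← Complex.exp_add, ← Complex.exp_add]
    congr 1
    push_cast
    ring
  rw [ferrersP, hE, ← mul_assoc, hpow, evenOddGauss, ferrersW₁, ferrersW₂]
  rw [show (ν - μ + 1 + 1) / 2 = (ν - μ) / 2 + 1 by ring,
    show (-(ν + μ) + 1) / 2 = (1 - ν - μ) / 2 by ring]
  rw [show (-(ν + μ) + 1) / 2 = (1 - ν - μ) / 2 by ring] at g1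
  simp only [div_eq_mul_inv _ (Complex.Gamma _)]
  set F1 := Complex.regularizedGaussHGFun (-(ν + μ) / 2) ((ν - μ + 1) / 2) (1 / 2) ((x ^ 2 : ℝ) : ℂ)
  set F2 := Complex.regularizedGaussHGFun ((1 - ν - μ) / 2) ((ν - μ) / 2 + 1) (3 / 2)
    ((x ^ 2 : ℝ) : ℂ)
  set G1 := (Complex.Gamma ((ν - μ) / 2 + 1))⁻¹
  set G2 := (Complex.Gamma ((ν - μ + 1) / 2))⁻¹
  set p := (2 : ℂ) ^ μ
  set q := ((1 - x ^ 2 : ℝ) : ℂ) ^ (-μ / 2)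
  linear_combination (-(p * q * F1 * G1)) * g1 + (p * q * x * F2 * G2) * g2

theorem ferrersW₁_neg (ν μ : ℂ) (x : ℝ) : ferrersW₁ ν μ (-x) = ferrersW₁ ν μ x := by
  simp [ferrersW₁]

theorem ferrersW₂_neg (ν μ : ℂ) (x : ℝ) : ferrersW₂ ν μ (-x) = -ferrersW₂ ν μ x := by
  simp [ferrersW₂]

/-- The pair (P, 2Q/π) is (w₁, w₂) rotated by θ = π(ν+μ)/2. Reflection changes the sign of w₂ only,
so the double angle appears. -/
theorem ferrersP_neg {ν μ : ℂ} (h : ∀ m : ℤ, ν + μ ≠ m) (hμ : ∀ m : ℕ, 1 - μ ≠ -m) {x : ℝ}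
    (hx : |x| < 1) :
    ferrersP ν μ (-x) = Complex.cos (Real.pi * (ν + μ)) * ferrersP ν μ x
      - 2 / Real.pi * Complex.sin (Real.pi * (ν + μ)) * ferrersQ ν μ x := by
  have hpi : (Real.pi : ℂ) ≠ 0 := by exact_mod_cast Real.pi_ne_zero
  have hx' : |-x| < 1 := by rwa [abs_neg]
  rw [ferrersP_eq_cos_mul_add_sin_mul h hμ hx', ferrersP_eq_cos_mul_add_sin_mul h hμ hx, ferrersQ,
    ferrersW₁_neg, ferrersW₂_neg]
  have e : (Real.pi : ℂ) * (ν + μ) = 2 * (Real.pi * (ν + μ) / 2) := by ring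
  rw [show Complex.cos (Real.pi * (ν + μ)) = Complex.cos (2 * (Real.pi * (ν + μ) / 2)) by rw [← e],
    show Complex.sin (Real.pi * (ν + μ)) = Complex.sin (2 * (Real.pi * (ν + μ) / 2)) by rw [← e],
    Complex.cos_two_mul, Complex.sin_two_mul]
  set c := Complex.cos (Real.pi * (ν + μ) / 2)
  set s := Complex.sin (Real.pi * (ν + μ) / 2)
  have hcs : s ^ 2 + c ^ 2 = 1 := Complex.sin_sq_add_cos_sq _
  field_simp
  linear_combination (-2 * c * ferrersW₁ ν μ x) * hcs

/-! ### Gegenbauer polynomials as Gauss functions -/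

/-- With A = ν and c = 1-μ this is the three-term recurrence of P_ν^μ in the degree ν. -/
theorem regularizedGaussHGFun_degree_recurrence (A c : ℂ) {z : ℂ} (hz : ‖z‖ < 1) :
    (A + c) * Complex.regularizedGaussHGFun (A + 2) (-1 - A) c z
      = (2 * A + 1) * (1 - 2 * z) * Complex.regularizedGaussHGFun (A + 1) (-A) c z
        - (A + 1 - c) * Complex.regularizedGaussHGFun A (1 - A) c z := by
  have h0 := hasSum_gaussCoeff (A + 2) (-1 - A) c hz
  have h1 := hasSum_gaussCoeff (A + 1) (-A) c hz
  have h1' := hasSum_shiftCoeff h1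
  have h2 := hasSum_gaussCoeff A (1 - A) c hz
  have h := ((h1.mul_left (2 * A + 1)).sub (h1'.mul_left (2 * (2 * A + 1)))).sub
    (h2.mul_left (A + 1 - c))
  refine ((h0.mul_left (A + c)).unique (h.congr_terms fun k => ?_)).trans (by ring)
  have s1 : -1 - A + 1 = -A := by ring
  have s2 : -A + 1 = 1 - A := by ring
  have s3 : A + 1 + 1 = A + 2 := by ring
  match k with
  | 0 =>
    simp [shiftCoeff, gaussCoeff]
    ring
  | 1 =>
    simp [shiftCoeff, gaussCoeff_eq, inv_Gamma_succ c]
    ring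
  | k + 2 =>
    have p1 : (ascPochhammer ℂ (k + 2)).eval (A + 2)
        = (ascPochhammer ℂ k).eval (A + 2) * (A + 2 + k) * (A + 3 + k) := by
      rw [ascPochhammer_succ_eval, ascPochhammer_succ_eval]; push_cast; ring
    have p2 : (ascPochhammer ℂ (k + 2)).eval (A + 1)
        = (A + 1) * (ascPochhammer ℂ k).eval (A + 2) * (A + 2 + k) := by
      rw [ascPochhammer_eval_succ_left, ascPochhammer_succ_eval, s3]; ring
    have p3 : (ascPochhammer ℂ (k + 1)).eval (A + 1)
        = (A + 1) * (ascPochhammer ℂ k).eval (A + 2) := by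
      rw [ascPochhammer_eval_succ_left, s3]
    have p4 : (ascPochhammer ℂ (k + 2)).eval A
        = A * (A + 1) * (ascPochhammer ℂ k).eval (A + 2) := by
      rw [ascPochhammer_eval_succ_left, p3]; ring
    have q1 : (ascPochhammer ℂ (k + 2)).eval (1 - A)
        = (ascPochhammer ℂ k).eval (1 - A) * (1 - A + k) * (2 - A + k) := by
      rw [ascPochhammer_succ_eval, ascPochhammer_succ_eval]; push_cast; ring
    have q2 : (ascPochhammer ℂ (k + 2)).eval (-A)
        = -A * (ascPochhammer ℂ k).eval (1 - A) * (1 - A + k) := by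
      rw [ascPochhammer_eval_succ_left, ascPochhammer_succ_eval, s2]; ring
    have q3 : (ascPochhammer ℂ (k + 1)).eval (-A) = -A * (ascPochhammer ℂ k).eval (1 - A) := by
      rw [ascPochhammer_eval_succ_left, s2]
    have q4 : (ascPochhammer ℂ (k + 2)).eval (-1 - A)
        = (-1 - A) * -A * (ascPochhammer ℂ k).eval (1 - A) := by
      rw [ascPochhammer_eval_succ_left, s1, q3]; ring
    have c1 : c + (k + 2 : ℕ) = c + k + 1 + 1 := by push_cast; ring
    have c2 : c + (k + 1 : ℕ) = c + k + 1 := by push_cast; ring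
    simp only [shiftCoeff, gaussCoeff_eq, p1, p2, p3, p4, q1, q2, q3, q4, c1, c2,
      inv_Gamma_succ (c + k + 1), inv_factorial (k + 1)]
    push_cast
    ring

/-- The upper parameter c cancels the lower one and leaves a binomial series. -/
theorem regularizedGaussHGFun_self_one_sub {c : ℂ} (hc : ∀ m : ℕ, c ≠ -m) {z : ℂ} (hz : ‖z‖ < 1) :
    Complex.regularizedGaussHGFun c (1 - c) c z = (Complex.Gamma c)⁻¹ * (1 - z) ^ (c - 1) := by
  have h := (hasSum_binomial (1 - c) hz).mul_left (Complex.Gamma c)⁻¹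
  rw [neg_sub] at h
  refine (hasSum_gaussCoeff c (1 - c) c hz).unique (h.congr_terms fun k => ?_)
  have hk : (k.factorial : ℂ) ≠ 0 := by exact_mod_cast k.factorial_ne_zero
  have h1 : Complex.Gamma c ≠ 0 := Complex.Gamma_ne_zero hc
  have h2 : Complex.Gamma (c + k) ≠ 0 := Complex.Gamma_ne_zero fun m hm => hc (m + k) (by
    push_cast
    linear_combination hm)
  rw [gaussCoeff]
  rw [Gamma_add_natCast hc] at h2 ⊢
  have h3 := left_ne_zero_of_mul h2
  field_simp

/-- The degree recurrence at A = c-1 gives this only multiplied by 2c-1. Comparing coefficients also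
covers c = 1/2, that is l = 0. -/
theorem regularizedGaussHGFun_add_one_neg (c : ℂ) {z : ℂ} (hz : ‖z‖ < 1) :
    Complex.regularizedGaussHGFun (c + 1) (-c) c z
      = (1 - 2 * z) * Complex.regularizedGaussHGFun c (1 - c) c z := by
  have h0 := hasSum_gaussCoeff (c + 1) (-c) c hz
  have h1 := hasSum_gaussCoeff c (1 - c) c hz
  have h := h1.sub ((hasSum_shiftCoeff h1).mul_left 2)
  refine (h0.unique (h.congr_terms fun k => ?_)).trans (by ring)
  match k with
  | 0 => simp [shiftCoeff, gaussCoeff]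
  | k + 1 =>
    have c1 : c + (k + 1 : ℕ) = c + k + 1 := by push_cast; ring
    have p : c * (ascPochhammer ℂ k).eval (c + 1) = (ascPochhammer ℂ k).eval c * (c + k) := by
      rw [← ascPochhammer_eval_succ_left, ascPochhammer_succ_eval]
    simp only [shiftCoeff, gaussCoeff_eq, ascPochhammer_succ_eval k (c + 1),
      ascPochhammer_eval_succ_left k (-c), show -c + 1 = 1 - c by ring,
      ascPochhammer_succ_eval k (1 - c), ascPochhammer_succ_eval k c, c1, inv_Gamma_succ (c + k),
      inv_factorial k]
    linear_combination (-(c + 1 + k) * (ascPochhammer ℂ k).eval (1 - c)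
      * (((k + 1).factorial : ℕ) : ℂ)⁻¹ * (Complex.Gamma (c + k + 1))⁻¹ * z ^ (k + 1)) * p

/-- The Gauss function `F(n+l+1/2, 1/2-n-l; l+1/2; z) / Γ(l+1/2)`, a multiple of
`(1-z)^(l-1/2) C_n^l(1-2z)`. -/
noncomputable def gegenbauerGauss (n : ℕ) (l z : ℂ) : ℂ :=
  Complex.regularizedGaussHGFun (n + l + 1 / 2) (1 / 2 - n - l) (l + 1 / 2) z

theorem gegenbauerGauss_zero {l : ℂ} (hl : -(1 / 2) < l.re) {z : ℂ} (hz : ‖z‖ < 1) :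
    gegenbauerGauss 0 l z = (Complex.Gamma (l + 1 / 2))⁻¹ * (1 - z) ^ (l - 1 / 2) := by
  have hc : 0 < (l + 1 / 2).re := by
    simp
    norm_num at hl ⊢
    linarith
  have h := regularizedGaussHGFun_self_one_sub (ne_neg_natCast_of_re_pos hc) hz
  rw [gegenbauerGauss]
  convert h using 2 <;> push_cast <;> ring_nf

theorem gegenbauerGauss_one (l : ℂ) {z : ℂ} (hz : ‖z‖ < 1) :
    gegenbauerGauss 1 l z = (1 - 2 * z) * gegenbauerGauss 0 l z := by
  have h := regularizedGaussHGFun_add_one_neg (l + 1 / 2) hz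
  rw [gegenbauerGauss, gegenbauerGauss]
  convert h using 2 <;> push_cast <;> ring_nf

theorem gegenbauerGauss_add_two (n : ℕ) (l : ℂ) {z : ℂ} (hz : ‖z‖ < 1) :
    (n + 1 + 2 * l) * gegenbauerGauss (n + 2) l z
      = 2 * (n + 1 + l) * (1 - 2 * z) * gegenbauerGauss (n + 1) l z
        - (n + 1) * gegenbauerGauss n l z := by
  have h := regularizedGaussHGFun_degree_recurrence (n + l + 1 / 2) (l + 1 / 2) hz
  simp only [gegenbauerGauss]
  push_cast
  rw [show (n : ℂ) + 2 + l + 1 / 2 = n + l + 1 / 2 + 2 by ring,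
    show 1 / 2 - ((n : ℂ) + 2) - l = -1 - (n + l + 1 / 2) by ring,
    show (n : ℂ) + 1 + l + 1 / 2 = n + l + 1 / 2 + 1 by ring,
    show 1 / 2 - ((n : ℂ) + 1) - l = -(n + l + 1 / 2) by ring,
    show 1 / 2 - (n : ℂ) - l = 1 - (n + l + 1 / 2) by ring]
  linear_combination h

/-- The factor (2l)_n/n! converts the recurrence of the Gauss functions into that of C_n^l, and the
first two cases agree. -/
theorem gegenbauer_mul_gegenbauerGauss_zero (l : ℂ) {z : ℂ} (hz : ‖z‖ < 1) (n : ℕ) :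
    gegenbauer n l (1 - 2 * z) * gegenbauerGauss 0 l z
      = (ascPochhammer ℂ n).eval (2 * l) / (n.factorial : ℂ) * gegenbauerGauss n l z := by
  induction n using Nat.strong_induction_on with
  | _ n ih =>
    match n with
    | 0 => simp [gegenbauer]
    | 1 =>
      simp [gegenbauer, gegenbauerGauss_one l hz]
      ring
    | n + 2 =>
      have h0 := ih n (by omega)
      have h1 := ih (n + 1) (by omega)
      have h := gegenbauerGauss_add_two n l hz
      have hn1 : (n : ℂ) + 1 ≠ 0 := by exact_mod_cast Nat.succ_ne_zero n
      have hn2 : (n : ℂ) + 2 ≠ 0 := by exact_mod_cast Nat.succ_ne_zero (n + 1)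
      have hk : (n.factorial : ℂ) ≠ 0 := by exact_mod_cast n.factorial_ne_zero
      simp only [gegenbauer, ascPochhammer_succ_eval, Nat.factorial_succ] at h0 h1 ⊢
      push_cast at h0 h1 ⊢
      have e : (n : ℂ) + 1 + 1 = n + 2 := by ring
      rw [e]
      rw [div_mul_eq_mul_div, sub_mul, mul_assoc _ (gegenbauer (n + 1) l _),
        mul_assoc _ (gegenbauer n l _), h0, h1]
      field_simp
      linear_combination (-(ascPochhammer ℂ n).eval (2 * l) * (2 * l + n)) * h

/-- At l = 0 the Gegenbauer identity is 0 = 0 for n ≥ 1; the Chebyshev recurrence supplies the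
missing case. -/
theorem chebyshev_mul_gegenbauerGauss_zero {z : ℂ} (hz : ‖z‖ < 1) (n : ℕ) :
    (Polynomial.Chebyshev.T ℂ n).eval (1 - 2 * z) * gegenbauerGauss 0 0 z
      = gegenbauerGauss n 0 z := by
  induction n using Nat.strong_induction_on with
  | _ n ih =>
    match n with
    | 0 => simp
    | 1 => simp [gegenbauerGauss_one 0 hz]
    | n + 2 =>
      have h0 := ih n (by omega)
      have h1 := ih (n + 1) (by omega)
      have h := gegenbauerGauss_add_two n 0 hz
      have hn1 : (n : ℂ) + 1 ≠ 0 := by exact_mod_cast Nat.succ_ne_zero n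
      have hT := congrArg (Polynomial.eval (1 - 2 * z)) (Polynomial.Chebyshev.T_add_two ℂ (n : ℤ))
      simp only [Polynomial.eval_sub, Polynomial.eval_mul, Polynomial.eval_ofNat,
        Polynomial.eval_X] at hT
      push_cast at h1 ⊢
      rw [hT]
      refine mul_left_cancel₀ hn1 ?_
      linear_combination 2 * (1 - 2 * z) * (n + 1) * h1 - (n + 1) * h0 - h

theorem weightedGegenbauer_mul_cpow {n : ℕ} {l : ℂ} (hl : -(1 / 2) < l.re) {z : ℂ} (hz : ‖z‖ < 1) :
    weightedGegenbauer n l (1 - 2 * z) * (1 - z) ^ (l - 1 / 2)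
      = (√Real.pi : ℝ) * gammaFactor n l
        / (2 ^ (2 * l - 1) * (n.factorial : ℂ) * Complex.Gamma (l + 1)) * gegenbauerGauss n l z := by
  have hc : 0 < (l + 1 / 2).re := by
    simp
    norm_num at hl ⊢
    linarith
  have hG := Complex.Gamma_ne_zero_of_re_pos hc
  have hpi := ofReal_sqrt_pi_ne_zero
  have hB : (1 - z) ^ (l - 1 / 2) = Complex.Gamma (l + 1 / 2) * gegenbauerGauss 0 l z := by
    rw [gegenbauerGauss_zero hl hz, mul_inv_cancel_left₀ hG]
  have hk : (n.factorial : ℂ) ≠ 0 := by exact_mod_cast n.factorial_ne_zero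
  rw [hB]
  by_cases h0 : l = 0
  · subst h0
    have hpi2 : Complex.Gamma (1 / 2) = (√Real.pi : ℝ) := by
      have := Complex.Gamma_mul_Gamma_add_half (1 / 2)
      norm_num at this ⊢
      exact this
    rw [zero_add, hpi2]
    have h := chebyshev_mul_gegenbauerGauss_zero hz n
    rcases Nat.eq_zero_or_pos n with rfl | hn
    · simp [weightedGegenbauer, gammaFactor, Complex.cpow_neg_one]
    · have hn0 : n ≠ 0 := hn.ne'
      have hf : (n : ℂ) * Complex.Gamma n = n.factorial := by
        rw [← Complex.Gamma_add_one _ (by exact_mod_cast hn0), Complex.Gamma_nat_eq_factorial]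
      simp [weightedGegenbauer, gammaFactor, Complex.cpow_neg_one, hn0, hf]
      field_simp
      linear_combination h
  · have h := gegenbauer_mul_gegenbauerGauss_zero l hz n
    -- Since Re 2l > -1, the only pole of Γ that 2l could meet is 0, excluded here.
    have h2l : ∀ m : ℕ, 2 * l ≠ -m := by
      intro m hm
      rcases Nat.eq_zero_or_pos m with rfl | hm0
      · simp [h0] at hm
      · have := congrArg Complex.re hm
        have h1 : (1 : ℝ) ≤ m := by exact_mod_cast hm0
        simp at this
        linarith
    have hGl : Complex.Gamma l ≠ 0 := Complex.Gamma_ne_zero fun m hm => h2l (2 * m) (by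
      push_cast
      linear_combination 2 * hm)
    have h2 : (2 : ℂ) ^ (2 * l - 1) ≠ 0 := by simp [Complex.cpow_eq_zero_iff]
    have hg : gammaFactor n l = (n + l) * ((ascPochhammer ℂ n).eval (2 * l)
        * (Complex.Gamma l * Complex.Gamma (l + 1 / 2) * 2 ^ (2 * l - 1) / (√Real.pi : ℝ))) := by
      rw [gammaFactor, if_neg (by simp [h0]), add_comm (n : ℂ) (2 * l), Gamma_add_natCast h2l,
        Gamma_two_mul]
    rw [weightedGegenbauer, if_neg h0, hg, Complex.Gamma_add_one _ h0]
    generalize Complex.Gamma (l + 1 / 2) = g at *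
    generalize (ascPochhammer ℂ n).eval (2 * l) = p at *
    field_simp
    field_simp at h
    linear_combination (n + l) * h

/-! ### The substitution and the resulting Beta-type integral -/

theorem gegenbauer_neg (l t : ℂ) (n : ℕ) : gegenbauer n l (-t) = (-1) ^ n * gegenbauer n l t := by
  induction n using Nat.strong_induction_on with
  | _ n ih =>
    match n with
    | 0 => simp [gegenbauer]
    | 1 => simp [gegenbauer]
    | n + 2 =>
      simp only [gegenbauer, ih n (by omega), ih (n + 1) (by omega)]
      ring

theorem weightedGegenbauer_neg (n : ℕ) (l t : ℂ) :
    weightedGegenbauer n l (-t) = (-1) ^ n * weightedGegenbauer n l t := by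
  rw [weightedGegenbauer, weightedGegenbauer]
  split_ifs with h0 hn
  · simp [hn]
  · rw [Polynomial.Chebyshev.T_eval_neg]
    simp
    ring
  · rw [gegenbauer_neg]
    ring

theorem continuous_gegenbauer (l : ℂ) (n : ℕ) : Continuous (gegenbauer n l) := by
  induction n using Nat.strong_induction_on with
  | _ n ih =>
    match n with
    | 0 => exact continuous_const
    | 1 =>
      change Continuous fun t => 2 * l * t
      fun_prop
    | n + 2 =>
      have h0 := ih n (by omega)
      have h1 := ih (n + 1) (by omega)
      change Continuous fun t => (2 * ((n : ℂ) + 1 + l) * t * gegenbauer (n + 1) l t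
        - ((n : ℂ) + 2 * l) * gegenbauer n l t) / ((n : ℂ) + 2)
      fun_prop

theorem continuous_weightedGegenbauer (n : ℕ) (l : ℂ) : Continuous (weightedGegenbauer n l) := by
  unfold weightedGegenbauer
  have := continuous_gegenbauer l n
  split_ifs <;> fun_prop

/-- Under the substitution 1-t² = 2(1+x)u(1-yu) with y = (1+x)/2, and x-t = (1+x)(1-u). All bases
are positive, so the complex powers split. -/
theorem gegenbauerIntegrand_comp {n : ℕ} {l κ : ℂ} {x : ℝ} (hx : x ∈ Set.Ioo (-1 : ℝ) 1) {u : ℝ}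
    (hu : u ∈ Set.Ioo (0 : ℝ) 1) :
    gegenbauerIntegrand n l κ x (-1 + (1 + x) * u)
      = (-1) ^ n * (((1 + x : ℝ) : ℂ) ^ (l - κ - 1) * 2 ^ (l - 1 / 2))
        * ((u : ℂ) ^ (l + 1 / 2 - 1) * (1 - (u : ℂ)) ^ (1 / 2 - κ - 1)
          * (weightedGegenbauer n l (1 - 2 * (((1 + x) / 2 * u : ℝ) : ℂ))
            * (1 - (((1 + x) / 2 * u : ℝ) : ℂ)) ^ (l - 1 / 2))) := by
  have h1 := hu.1
  have h2 : 0 < 1 - u := sub_pos.2 hu.2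
  have h3 : 0 < 1 + x := by linarith [hx.1]
  have h4 : 0 < 1 - (1 + x) / 2 * u := by nlinarith [hx.2, hu.2]
  have e1 : 1 - (-1 + (1 + x) * u) ^ 2 = (1 + x) * u * (2 * (1 - (1 + x) / 2 * u)) := by ring
  have e2 : x - (-1 + (1 + x) * u) = (1 + x) * (1 - u) := by ring
  have e3 : ((-1 + (1 + x) * u : ℝ) : ℂ) = -(1 - 2 * (((1 + x) / 2 * u : ℝ) : ℂ)) := by
    push_cast; ring
  have e4 : 1 - (((1 + x) / 2 * u : ℝ) : ℂ) = ((1 - (1 + x) / 2 * u : ℝ) : ℂ) := by push_cast; ring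
  have e5 : 1 - (u : ℂ) = ((1 - u : ℝ) : ℂ) := by push_cast; ring
  have e6 : ((1 + x : ℝ) : ℂ) ^ (l - κ - 1)
      = ((1 + x : ℝ) : ℂ) ^ (l - 1 / 2) * ((1 + x : ℝ) : ℂ) ^ (-κ - 1 / 2) := by
    rw [← Complex.cpow_add _ _ (by exact_mod_cast h3.ne')]
    congr 1
    ring
  rw [gegenbauerIntegrand, e1, e2, e3, weightedGegenbauer_neg, e4, e5, e6,
    Complex.ofReal_mul ((1 + x) * u), Complex.mul_cpow_ofReal_nonneg (by positivity) (by positivity),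
    Complex.ofReal_mul (1 + x), Complex.mul_cpow_ofReal_nonneg (by positivity) (by positivity),
    Complex.ofReal_mul 2, Complex.mul_cpow_ofReal_nonneg (by positivity) (by positivity),
    Complex.ofReal_mul (1 + x), Complex.mul_cpow_ofReal_nonneg (by positivity) (by positivity),
    show l + 1 / 2 - 1 = l - 1 / 2 by ring, show 1 / 2 - κ - 1 = -κ - 1 / 2 by ring,
    Complex.ofReal_ofNat]
  ring

theorem intervalIntegrable_gegenbauerIntegrand (n : ℕ) {l κ : ℂ} {x : ℝ}
    (hl : -(1 / 2) < l.re) (hκ : κ.re < 1 / 2) (hx : x ∈ Set.Ioo (-1 : ℝ) 1) :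
    IntervalIntegrable (fun t : ℝ => gegenbauerIntegrand n l κ x t) MeasureTheory.volume (-1) x := by
  have h3 : 0 < 1 + x := by linarith [hx.1]
  have hc : 0 < (l + 1 / 2).re := by
    simp
    norm_num at hl ⊢
    linarith
  have hd : 0 < (1 / 2 - κ).re := by
    simp
    norm_num at hκ ⊢
    linarith
  have h := ((Complex.betaIntegral_convergent hc hd).mul_continuousOn
    (g := fun u : ℝ => weightedGegenbauer n l (1 - 2 * (((1 + x) / 2 * u : ℝ) : ℂ))
      * (1 - (((1 + x) / 2 * u : ℝ) : ℂ)) ^ (l - 1 / 2)) (by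
        have hw := continuous_weightedGegenbauer n l
        intro u hu
        rw [Set.uIcc_of_le zero_le_one] at hu
        refine ContinuousAt.continuousWithinAt (ContinuousAt.mul (by fun_prop) ?_)
        refine ContinuousAt.cpow (by fun_prop) (by fun_prop) ?_
        rw [← Complex.ofReal_one, ← Complex.ofReal_sub]
        refine Complex.ofReal_mem_slitPlane.2 ?_
        nlinarith [hx.2, hu.2, hu.1])).const_mul
    ((-1) ^ n * (((1 + x : ℝ) : ℂ) ^ (l - κ - 1) * 2 ^ (l - 1 / 2)))
  have h' : IntervalIntegrable (fun u : ℝ => gegenbauerIntegrand n l κ x (-1 + (1 + x) * u))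
      MeasureTheory.volume 0 1 := by
    rw [intervalIntegrable_iff_integrableOn_Ioo_of_le zero_le_one] at h ⊢
    exact h.congr_fun (fun u hu => (gegenbauerIntegrand_comp hx hu).symm) measurableSet_Ioo
  -- Inverse substitution u = (t+1)/(1+x).
  have h'' := (h'.comp_mul_left (c := (1 + x)⁻¹)).comp_add_right 1
  convert h'' using 1
  · ext t
    congr 1
    field_simp
    ring
  · simp
  · field_simp
    ring

/-- The Beta integral of the k-th term has numerator Γ(l+1/2+k), which cancels the regularizing
denominator, and brings in Γ(l+1-κ+k) instead. -/
theorem integral_beta_mul_gegenbauerGauss (n : ℕ) {l κ : ℂ} (hl : -(1 / 2) < l.re)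
    (hκ : κ.re < 1 / 2) {y : ℝ} (hy0 : 0 ≤ y) (hy1 : y < 1) :
    ∫ u in (0 : ℝ)..1, (u : ℂ) ^ (l + 1 / 2 - 1) * (1 - (u : ℂ)) ^ (1 / 2 - κ - 1)
        * gegenbauerGauss n l ((y * u : ℝ) : ℂ)
      = Complex.Gamma (1 / 2 - κ)
        * Complex.regularizedGaussHGFun (n + l + 1 / 2) (1 / 2 - n - l) (l + 1 - κ) y := by
  have hc : 0 < (l + 1 / 2).re := by
    simp
    norm_num at hl ⊢
    linarith
  have hd : 0 < (1 / 2 - κ).re := by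
    simp
    norm_num at hκ ⊢
    linarith
  have hvr : ∀ u ∈ Set.Ioc (0 : ℝ) 1, |y * u| ≤ y := fun u hu => by
    rw [abs_of_nonneg (mul_nonneg hy0 hu.1.le)]
    exact mul_le_of_le_one_right hy0 hu.2
  have h := hasSum_integral_mul_powers (Complex.betaIntegral_convergent hc hd)
    (v := fun u => y * u) (by fun_prop) hvr
    (summable_norm_gaussCoeff (n + l + 1 / 2) (1 / 2 - n - l) (l + 1 / 2) hy0 hy1)
    (fun u hu => hasSum_gaussCoeff _ _ _ (norm_ofReal_lt_one ((hvr u hu).trans_lt hy1)))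
  refine h.unique (((hasSum_gaussCoeff _ _ _ (norm_ofReal_lt_one
    (by rwa [abs_of_nonneg hy0]))).mul_left _).congr_terms fun k => ?_)
  have hI : ∫ u in (0 : ℝ)..1, (u : ℂ) ^ (l + 1 / 2 - 1) * (1 - (u : ℂ)) ^ (1 / 2 - κ - 1)
        * ((y * u : ℝ) : ℂ) ^ k
      = y ^ k * Complex.betaIntegral (l + 1 / 2 + k) (1 / 2 - κ) := by
    rw [Complex.betaIntegral, ← intervalIntegral.integral_const_mul]
    refine intervalIntegral_congr_Ioo fun u hu => ?_
    have h1 : (u : ℂ) ≠ 0 := by exact_mod_cast hu.1.ne'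
    rw [show l + 1 / 2 + k - 1 = l + 1 / 2 - 1 + k by ring, Complex.cpow_add _ _ h1,
      Complex.cpow_natCast]
    push_cast
    simp only [mul_pow]
    ring
  have hck : 0 < (l + 1 / 2 + k).re := by
    rw [Complex.add_re, Complex.natCast_re]; positivity
  have hG := Complex.Gamma_ne_zero_of_re_pos hck
  rw [hI, Complex.betaIntegral_eq_Gamma_mul_div _ _ hck hd, gaussCoeff, gaussCoeff,
    show l + 1 / 2 + k + (1 / 2 - κ) = l + 1 - κ + k by ring]
  generalize Complex.Gamma (l + 1 / 2 + k) = g at hG ⊢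
  generalize Complex.Gamma (l + 1 - κ + k) = g'
  field_simp

/-! ### The two closed forms -/

theorem integral_gegenbauerIntegrand_eq_ferrersP (n : ℕ) {l κ : ℂ} {x : ℝ}
    (hl : -(1 / 2) < l.re) (hκ : κ.re < 1 / 2) (hx : x ∈ Set.Ioo (-1 : ℝ) 1) :
    (∫ t in (-1 : ℝ)..x, gegenbauerIntegrand n l κ x t)
      = (-1 : ℂ) ^ n
        * ((√Real.pi : ℂ) * gammaFactor n l * Complex.Gamma (1 / 2 - κ)
            / ((2 : ℂ) ^ (l - 1 / 2) * (n.factorial : ℂ) * Complex.Gamma (l + 1)))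
        * ((1 - x ^ 2 : ℝ) : ℂ) ^ ((l - κ) / 2)
        * ferrersP (n + l - 1 / 2) (κ - l) (-x) := by
  have h3 : 0 < 1 + x := by linarith [hx.1]
  have h4 : 0 < 1 - x := by linarith [hx.2]
  have hy0 : 0 < (1 + x) / 2 := by positivity
  have hy1 : (1 + x) / 2 < 1 := by linarith
  have h2 : (2 : ℂ) ^ (l - 1 / 2) ≠ 0 := by simp [Complex.cpow_eq_zero_iff]
  have hsub := intervalIntegral.integral_comp_add_mul (a := 0) (b := 1)
    (fun t => gegenbauerIntegrand n l κ x t) h3.ne' (-1)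
  rw [mul_zero, add_zero, mul_one, neg_add_cancel_left, eq_inv_smul_iff₀ h3.ne'] at hsub
  have hcongr : ∫ u in (0 : ℝ)..1, gegenbauerIntegrand n l κ x (-1 + (1 + x) * u)
      = ∫ u in (0 : ℝ)..1, ((-1) ^ n * (((1 + x : ℝ) : ℂ) ^ (l - κ - 1) * 2 ^ (l - 1 / 2))
          * ((√Real.pi : ℝ) * gammaFactor n l
            / (2 ^ (2 * l - 1) * (n.factorial : ℂ) * Complex.Gamma (l + 1))))
        * ((u : ℂ) ^ (l + 1 / 2 - 1) * (1 - (u : ℂ)) ^ (1 / 2 - κ - 1)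
          * gegenbauerGauss n l (((1 + x) / 2 * u : ℝ) : ℂ)) := by
    refine intervalIntegral_congr_Ioo fun u hu => ?_
    rw [gegenbauerIntegrand_comp hx hu, weightedGegenbauer_mul_cpow hl (norm_ofReal_lt_one ?_)]
    · ring
    · rw [abs_of_nonneg (mul_nonneg hy0.le hu.1.le)]
      nlinarith [hu.2]
  have e1 : (2 : ℂ) ^ (2 * l - 1) = 2 ^ (l - 1 / 2) * 2 ^ (l - 1 / 2) := by
    rw [← Complex.cpow_add _ _ two_ne_zero]
    congr 1
    ring
  -- The Jacobian 1+x completes the power (1+x)^(l-κ), which splits into the prefactor of the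
  -- formula and the power in P at -x.
  have e2 : ((1 + x : ℝ) : ℂ) * ((1 + x : ℝ) : ℂ) ^ (l - κ - 1)
      = ((1 - x ^ 2 : ℝ) : ℂ) ^ ((l - κ) / 2)
        * (((1 + -x) / (1 - -x) : ℝ) : ℂ) ^ ((κ - l) / 2) := by
    have e3 : 1 - x ^ 2 = (1 - x) * (1 + x) := by ring
    rw [e3, sub_neg_eq_add, ← sub_eq_add_neg, ofReal_cpow_eq_exp h3,
      ofReal_cpow_eq_exp (mul_pos h4 h3), ofReal_cpow_eq_exp (div_pos h4 h3),
      Real.log_div h4.ne' h3.ne', Real.log_mul h4.ne' h3.ne',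
      show ((1 + x : ℝ) : ℂ) * Complex.exp ((l - κ - 1) * (Real.log (1 + x) : ℝ))
        = Complex.exp (Real.log (1 + x) : ℝ) * Complex.exp ((l - κ - 1) * (Real.log (1 + x) : ℝ))
        by rw [← ofReal_eq_exp_log h3], ← Complex.exp_add, ← Complex.exp_add]
    congr 1
    push_cast
    ring
  rw [← hsub, hcongr, intervalIntegral.integral_const_mul,
    integral_beta_mul_gegenbauerGauss n hl hκ hy0.le hy1, ferrersP, Complex.real_smul,
    show (n : ℂ) + l - 1 / 2 + 1 = n + l + 1 / 2 by ring,
    show -((n : ℂ) + l - 1 / 2) = 1 / 2 - n - l by ring,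
    show 1 - (κ - l) = l + 1 - κ by ring, e1]
  rw [sub_neg_eq_add] at e2 ⊢
  set F := Complex.regularizedGaussHGFun (n + l + 1 / 2) (1 / 2 - n - l) (l + 1 - κ)
    (((1 + x) / 2 : ℝ) : ℂ)
  calc _ = ((1 + x : ℝ) : ℂ) * ((1 + x : ℝ) : ℂ) ^ (l - κ - 1) * ((-1) ^ n * ((√Real.pi : ℝ)
          * gammaFactor n l * Complex.Gamma (1 / 2 - κ)
          * ((2 ^ (l - 1 / 2)) / (2 ^ (l - 1 / 2) * 2 ^ (l - 1 / 2)
          * (n.factorial : ℂ) * Complex.Gamma (l + 1))) * F)) := by ring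
    _ = _ := by
      rw [e2, mul_assoc ((2 : ℂ) ^ (l - 1 / 2)), mul_assoc ((2 : ℂ) ^ (l - 1 / 2)),
        div_mul_cancel_left₀ h2]
      ring

theorem ne_intCast_of_re_lt_one {z : ℂ} (hz : z.re < 1) (h : ∀ m : ℕ, z ≠ -(m : ℂ)) (m : ℤ) :
    z ≠ m := by
  rintro rfl
  have hm : m < 1 := by exact_mod_cast (by simpa using hz : (m : ℝ) < 1)
  obtain ⟨k, hk⟩ := Int.exists_eq_neg_ofNat (by omega : m ≤ 0)
  exact h k (by rw [hk]; push_cast; rfl)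

theorem integral_gegenbauerIntegrand_eq_cotCombination (n : ℕ) {l κ : ℂ} {x : ℝ}
    (hl : -(1 / 2) < l.re) (hκ : κ.re < 1 / 2) (hx : x ∈ Set.Ioo (-1 : ℝ) 1)
    (h : ∀ m : ℕ, κ + 1 / 2 ≠ -(m : ℂ)) :
    (∫ t in (-1 : ℝ)..x, gegenbauerIntegrand n l κ x t) = cotCombination n l κ x := by
  have hx' : |x| < 1 := abs_lt.2 hx
  have hpi : (Real.pi : ℂ) ≠ 0 := by exact_mod_cast Real.pi_ne_zero
  -- Re κ < 1/2 rules out positive integers, so κ+1/2 is no integer at all and the sine below is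
  -- nonzero.
  have hint := ne_intCast_of_re_lt_one (z := κ + 1 / 2) (by
    simp
    norm_num at hκ ⊢
    linarith) h
  have hs0 : Complex.sin (Real.pi * (κ + 1 / 2)) ≠ 0 := by
    intro h0
    obtain ⟨k, hk⟩ := Complex.sin_eq_zero_iff.1 h0
    exact hint k (mul_left_cancel₀ hpi (by linear_combination hk))
  have hP := ferrersP_neg (ν := n + l - 1 / 2) (μ := κ - l) (fun m hm => hint (m - n + 1) (by
      push_cast
      linear_combination hm))
    (ne_neg_natCast_of_re_pos (by
      simp
      norm_num at hl hκ ⊢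
      linarith)) hx'
  -- Here ν+μ = κ+1/2+n-1, so the trigonometric factors change only by the sign (-1)^(n-1).
  have e : (Real.pi : ℂ) * ((n : ℂ) + l - 1 / 2 + (κ - l))
      = Real.pi * (κ + 1 / 2) + n * Real.pi - Real.pi := by ring
  rw [e, Complex.cos_sub_pi, Complex.sin_sub_pi, Complex.cos_antiperiodic.add_nat_mul_eq,
    Complex.sin_antiperiodic.add_nat_mul_eq] at hP
  have hG' : Complex.Gamma (1 / 2 - κ)
      = Real.pi * (Complex.Gamma (κ + 1 / 2))⁻¹ / Complex.sin (Real.pi * (κ + 1 / 2)) := by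
    have h0 : Complex.Gamma (κ + 1 / 2) ≠ 0 := Complex.Gamma_ne_zero h
    have := Complex.Gamma_mul_Gamma_one_sub (κ + 1 / 2)
    rw [show 1 - (κ + 1 / 2) = 1 / 2 - κ by ring] at this
    rw [eq_div_iff hs0] at this
    rw [eq_div_iff hs0, eq_mul_inv_iff_mul_eq₀ h0]
    linear_combination this
  have e2 : (2 : ℂ) ^ (l - 1 / 2) = 2 * 2 ^ (l - 3 / 2) := by
    rw [show l - 1 / 2 = 1 + (l - 3 / 2) by ring, Complex.cpow_add _ _ two_ne_zero,
      Complex.cpow_one]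
  have h1 : (-1 : ℂ) ^ n * (-1) ^ n = 1 := by rw [← mul_pow]; simp
  rw [integral_gegenbauerIntegrand_eq_ferrersP n hl hκ hx, hP, hG', cotCombination, Complex.cot, e2]
  set P := ferrersP (n + l - 1 / 2) (κ - l) x
  set Q := ferrersQ (n + l - 1 / 2) (κ - l) x
  set c := Complex.cos (Real.pi * (κ + 1 / 2))
  set s := Complex.sin (Real.pi * (κ + 1 / 2))
  set X := ((1 - x ^ 2 : ℝ) : ℂ) ^ ((l - κ) / 2)
  generalize (Complex.Gamma (κ + 1 / 2)) = g
  generalize (Complex.Gamma (l + 1)) = g'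
  have key : (-1 : ℂ) ^ n * (-((-1) ^ n * c) * P - 2 / Real.pi * -((-1) ^ n * s) * Q)
      = 2 * s / Real.pi * (Q - Real.pi / 2 * P * (c / s)) := by
    field_simp
    linear_combination (2 * s * Q - Real.pi * c * P) * h1
  calc _ = (√Real.pi : ℂ) * gammaFactor n l * (Real.pi * g⁻¹ / s)
            / (2 * 2 ^ (l - 3 / 2) * (n.factorial : ℂ) * g') * X
          * ((-1 : ℂ) ^ n * (-((-1) ^ n * c) * P - 2 / Real.pi * -((-1) ^ n * s) * Q)) := by ring
    _ = _ := by
      rw [key]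
      field_simp

/-! ### Continuity in κ and the exceptional values -/

theorem Real.rpow_le_add_rpow {r p q₁ q₂ : ℝ} (hr : 0 < r) (h₁ : q₁ ≤ p) (h₂ : p ≤ q₂) :
    r ^ p ≤ r ^ q₁ + r ^ q₂ := by
  rcases le_total r 1 with h | h
  · exact (Real.rpow_le_rpow_of_exponent_ge hr h h₁).trans
      (le_add_of_nonneg_right (Real.rpow_nonneg hr.le _))
  · exact (Real.rpow_le_rpow_of_exponent_le h h₂).trans
      (le_add_of_nonneg_left (Real.rpow_nonneg hr.le _))

/-- For s near κ the norm of (x-t)^(-s-1/2) is at most the sum of its norms at κ-ε and κ+ε: one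
controls small x-t, the other large. Both integrands are integrable since Re κ + ε < 1/2. -/
theorem continuousAt_integral_gegenbauerIntegrand (n : ℕ) {l κ : ℂ} {x : ℝ}
    (hl : -(1 / 2) < l.re) (hκ : κ.re < 1 / 2) (hx : x ∈ Set.Ioo (-1 : ℝ) 1) :
    ContinuousAt (fun s : ℂ => ∫ t in (-1 : ℝ)..x, gegenbauerIntegrand n l s x t) κ := by
  obtain ⟨ε, hε, hκε⟩ : ∃ ε : ℝ, 0 < ε ∧ κ.re + ε < 1 / 2 :=
    ⟨(1 / 2 - κ.re) / 2, by linarith, by linarith⟩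
  have hre : ∀ᶠ s : ℂ in 𝓝 κ, s.re ∈ Set.Ioo (κ.re - ε) (κ.re + ε) :=
    Complex.continuous_re.continuousAt (Ioo_mem_nhds (by linarith) (by linarith))
  have hne : ∀ᵐ t : ℝ, t ≠ x := by
    rw [MeasureTheory.ae_iff]
    simp
  refine intervalIntegral.continuousAt_of_dominated_interval
    (bound := fun t => ‖gegenbauerIntegrand n l (κ - ε) x t‖
      + ‖gegenbauerIntegrand n l (κ + ε) x t‖)
    ?_ ?_ ?_ ?_
  · filter_upwards [hre] with s hs
    exact (intervalIntegrable_gegenbauerIntegrand n hl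
      (hs.2.trans hκε) hx).aestronglyMeasurable_restrict_uIoc
  · filter_upwards [hre] with s hs
    filter_upwards [hne] with t ht hmem
    rw [Set.uIoc_of_le hx.1.le] at hmem
    have hr : 0 < x - t := sub_pos.2 (lt_of_le_of_ne hmem.2 ht)
    simp only [gegenbauerIntegrand, norm_mul, Complex.norm_cpow_eq_rpow_re_of_pos hr]
    rw [← add_mul, ← mul_add]
    gcongr
    rw [add_comm]
    refine Real.rpow_le_add_rpow hr ?_ ?_
    · simp; linarith [hs.2]
    · simp; linarith [hs.1]
  · exact (intervalIntegrable_gegenbauerIntegrand n hl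
        (by simp; norm_num at hκε ⊢; linarith) hx).norm.add
      (intervalIntegrable_gegenbauerIntegrand n hl (by simpa using hκε) hx).norm
  · filter_upwards [hne] with t ht hmem
    have hr : ((x - t : ℝ) : ℂ) ≠ 0 := by exact_mod_cast sub_ne_zero.2 (Ne.symm ht)
    unfold gegenbauerIntegrand
    have : ContinuousAt (fun s : ℂ => ((x - t : ℝ) : ℂ) ^ (-s - 1 / 2)) κ :=
      ContinuousAt.const_cpow (by fun_prop) (Or.inl hr)
    fun_prop

theorem mainTheorem2 (n : ℕ) (lam κ : ℂ) (x : ℝ)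
    (hlam : -(1 / 2) < lam.re) (hκ : κ.re < 1 / 2) (hx : x ∈ Set.Ioo (-1 : ℝ) 1) :
    IntervalIntegrable (fun t : ℝ => gegenbauerIntegrand n lam κ x t) MeasureTheory.volume (-1) x ∧
    (∫ t in (-1 : ℝ)..x, gegenbauerIntegrand n lam κ x t)
      = (-1 : ℂ) ^ n
        * ((√Real.pi : ℂ) * gammaFactor n lam * Complex.Gamma (1 / 2 - κ)
            / ((2 : ℂ) ^ (lam - 1 / 2) * (n.factorial : ℂ) * Complex.Gamma (lam + 1)))
        * ((1 - x ^ 2 : ℝ) : ℂ) ^ ((lam - κ) / 2)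
        * ferrersP (n + lam - 1 / 2) (κ - lam) (-x) ∧
    ((∀ m : ℕ, κ + 1 / 2 ≠ -(m : ℂ)) →
      (∫ t in (-1 : ℝ)..x, gegenbauerIntegrand n lam κ x t) = cotCombination n lam κ x) ∧
    ((∃ m : ℕ, κ + 1 / 2 = -(m : ℂ)) →
      Tendsto (fun s : ℂ => cotCombination n lam s x) (𝓝[≠] κ)
        (𝓝 (∫ t in (-1 : ℝ)..x, gegenbauerIntegrand n lam κ x t))) := by
  refine ⟨intervalIntegrable_gegenbauerIntegrand n hlam hκ hx,
    integral_gegenbauerIntegrand_eq_ferrersP n hlam hκ hx,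
    integral_gegenbauerIntegrand_eq_cotCombination n hlam hκ hx, ?_⟩
  rintro ⟨m, hm⟩
  refine ((continuousAt_integral_gegenbauerIntegrand n hlam hκ hx).tendsto.mono_left
    nhdsWithin_le_nhds).congr' ?_
  have hre : ∀ᶠ s : ℂ in 𝓝[≠] κ, s.re < 1 / 2 :=
    nhdsWithin_le_nhds (Complex.continuous_re.continuousAt (Iio_mem_nhds hκ))
  -- Exceptional values of κ differ by integers, so the open unit ball around κ contains no other.
  have hball : ∀ᶠ s : ℂ in 𝓝[≠] κ, dist s κ < 1 :=
    nhdsWithin_le_nhds (Metric.ball_mem_nhds κ one_pos)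
  filter_upwards [hre, hball, self_mem_nhdsWithin] with s hs hd hne
  refine integral_gegenbauerIntegrand_eq_cotCombination n hlam hs hx fun k hk => hne ?_
  have hsub : s - κ = ((m - k : ℤ) : ℂ) := by
    push_cast
    linear_combination hk - hm
  rw [dist_eq_norm, hsub, Complex.norm_intCast] at hd
  have h0 : (m - k : ℤ) = 0 := Int.abs_lt_one_iff.1 (by exact_mod_cast hd)
  rw [h0, Int.cast_zero, sub_eq_zero] at hsub
  exact hsub
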